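/- **Setting.** Fix $k\ge 1$. For the joint law of finitely many finitely valued random variables $(X_v)_{v\in W}$, let $\mathcal G_{W,k}$ be the set of directed acyclic graphs on $W$ in which every node has at most $k$ parents. The score of $G\in\mathcal G_{W,k}$ is $\mathcal S(G)=-\sum_{i\in W}H(X_i\mid \Pi_i(G))$, where $\Pi_i(G)$ is the set of parents of $X_i$ and $H$ is conditional Shannon entropy, and $\mathcal S^*=\max_{G\in\mathcal G_{W,k}}\mathcal S(G)$. Two graphs are Markov equivalent if they induce the same conditional independence constraints (those which hold for all finitely valued random vectors generated by the graph). An equivalence class (EC) is a class of this relation on $\mathcal G_{W,k}$. All graphs of an EC have the same score, which is called the score of the EC, and an EC is optimal if its score is $\mathcal S^*$. Let $\mathcal D_1$ be the law of at least two finitely valued random variables $\mathbf X_1=(X_v)_{v\in V}$, let $a\in V$ and $\alpha,\beta>0$, and assume: (I) $\mathcal D_1$ has a unique optimal EC, and every other EC has a score smaller by at least $\beta$; (II) $X_a$ has no children in any graph of the optimal EC; (III) $H(X_a\mid \mathbf X_1\setminus\{X_a\})=\alpha$. Put $d=|V|+1$. For $\lambda\in(0,\min(\alpha,\frac{\beta}{3d}))$,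 a law $\mathcal D_2(\lambda)$ of $\mathbf X=\mathbf X_1\cup\{X_b\}$ is obtained by adding to $\mathbf X_1\sim\mathcal D_1$ a noisy copy $X_b$ of $X_a$: for a hidden Bernoulli variable $C$ independent of $\mathbf X_1$, $X_b=X_a$ if $C=1$, and, given $C=0$, $X_b$ is independent of $\mathbf X_1$ with some law $\nu$ on a finite set; the probability $P(C=1)$ is such that $\max(H(X_b\mid X_a),H(X_a\mid X_b))=\lambda$. **Theorem.** For every $\varepsilon\in\left(0,\,2\min(\alpha,\frac{\beta}{3d})\right)$ there is a $\lambda\in\left(0,\min(\alpha,\frac{\beta}{3d})\right)$ such that, for every noise law $\nu$, there is a value of $P(C=1)$ that gives a distribution $\mathcal D_2(\lambda)$, and for each such distribution $\mathcal D_2(\lambda)$ there is a non-optimal EC in $\mathcal G_{V\cup\{b\},k}$ with a score of at least $\mathcal S^*-\varepsilon$, where scores and $\mathcal S^*$ are with respect to $\mathcal D_2(\lambda)$. -/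

import Mathlib

namespace BayesNet

/-! ### Discrete conditional entropy and conditional independence -/

/-- The conditional Shannon entropy `H(f ∣ g) = ∑ b, P(g = b) H(f ∣ g = b)` (natural logarithm) of
two finitely valued random variables `f`, `g` on a discrete probability space with law `P`.
Values `b` of probability zero contribute zero. -/
noncomputable def condEntropy {Ω A B : Type*} [Fintype A] [Fintype B]
    (P : PMF Ω) (f : Ω → A) (g : Ω → B) : ℝ :=
  ∑ b : B, (P.map g b).toReal *
    ∑ a : A, Real.negMulLog ((P.map (fun ω => (f ω, g ω)) (a, b)).toReal / (P.map g b).toReal)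

/-- Conditional independence `f ⊥ g ∣ h` of discrete random variables:
`P(f = a, g = b, h = c) P(h = c) = P(f = a, h = c) P(g = b, h = c)` for all `a`, `b`, `c`. -/
def CondIndep {Ω A B C : Type*} (P : PMF Ω) (f : Ω → A) (g : Ω → B) (h : Ω → C) : Prop :=
  ∀ a b c, P.map (fun ω => (f ω, g ω, h ω)) (a, b, c) * P.map h c =
    P.map (fun ω => (f ω, h ω)) (a, c) * P.map (fun ω => (g ω, h ω)) (b, c)

/-! ### Directed acyclic graphs and their scores -/

/-- A directed acyclic graph on the node set `V`, given by the parent set of every node. -/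
@[ext] structure DAG (V : Type*) where
  /-- The parents of a node. -/
  pa : V → Finset V
  /-- There is no directed cycle. -/
  acyclic : ∀ v, ¬ Relation.TransGen (fun i j => i ∈ pa j) v v

/-- The DAGs on `V` in which every node has at most `k` parents. -/
def structs (V : Type*) (k : ℕ) : Set (DAG V) :=
  {G | ∀ i, (G.pa i).card ≤ k}

/-- The entropy `H(X_i ∣ X_S)` of the family with child `i` and parent set `S`, where `P` is the joint law of the random
variables `(X_v)_{v ∈ V}`, all with values in `𝒳`. -/
noncomputable def familyEntropy {V 𝒳 : Type*} [Fintype 𝒳] [DecidableEq V]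
    (P : PMF (V → 𝒳)) (i : V) (S : Finset V) : ℝ :=
  condEntropy P (fun x => x i) (fun x (j : S) => x j)

/-- The score `-∑ i, H(X_i ∣ Π_i(G))` of a DAG. -/
noncomputable def score {V 𝒳 : Type*} [Fintype V] [Fintype 𝒳] [DecidableEq V]
    (P : PMF (V → 𝒳)) (G : DAG V) : ℝ :=
  -∑ i, familyEntropy P i (G.pa i)

/-- The optimal score of a DAG with at most `k` parents per node (the supremum of a finite
non-empty set of scores). -/
noncomputable def optScore {V 𝒳 : Type*} [Fintype V] [Fintype 𝒳] [DecidableEq V]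
    (P : PMF (V → 𝒳)) (k : ℕ) : ℝ :=
  sSup (score P '' structs V k)

/-! ### Markov equivalence -/

/-- `P` is generated by the Bayesian network `G` for some choice of parameters, i.e. of
conditional laws `θ i` of `X_i` given its parents. -/
def Factorizes {V 𝒳 : Type*} [Fintype V] (P : PMF (V → 𝒳)) (G : DAG V) : Prop :=
  ∃ θ : ∀ i, (G.pa i → 𝒳) → PMF 𝒳, ∀ x, P x = ∏ i, θ i (fun j => x j) (x i)

/-- The conditional independence constraints induced by `G`: the triples `(A, B, C)` of pairwise
disjoint sets of nodes such that `X_A ⊥ X_B ∣ X_C` for all finitely valued random vectors that are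
generated by `G`. -/
def ciConstraints {V : Type*} [Fintype V] (G : DAG V) : Set (Finset V × Finset V × Finset V) :=
  {T | Disjoint T.1 T.2.1 ∧ Disjoint T.1 T.2.2 ∧ Disjoint T.2.1 T.2.2 ∧
    ∀ (𝒳 : Type) [Fintype 𝒳] (P : PMF (V → 𝒳)), Factorizes P G →
      CondIndep P (fun x (j : T.1) => x j) (fun x (j : T.2.1) => x j) (fun x (j : T.2.2) => x j)}

/-- Two DAGs are Markov equivalent if they induce the same conditional independence constraints. -/
def MarkovEquiv {V : Type*} [Fintype V] (G G' : DAG V) : Prop :=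
  ciConstraints G = ciConstraints G'

/-- The Markov equivalence classes (ECs) on the set of DAGs with at most `k` parents per node. -/
def ecs (V : Type*) [Fintype V] (k : ℕ) : Set (Set (DAG V)) :=
  {E | ∃ G ∈ structs V k, E = {G' ∈ structs V k | MarkovEquiv G G'}}

/-- `E` is an optimal EC: an EC whose graphs have the optimal score. -/
def IsOptimalEC {V 𝒳 : Type*} [Fintype V] [Fintype 𝒳] [DecidableEq V]
    (P : PMF (V → 𝒳)) (k : ℕ) (E : Set (DAG V)) : Prop :=
  E ∈ ecs V k ∧ ∀ G ∈ E, score P G = optScore P k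

/-! ### The construction -/

/-- The assumptions on the base distribution `P` of the variables `(X_v)_{v ∈ V}` with the
distinguished variable `X_a`. -/
structure IsBase {V 𝒳 : Type*} [Fintype V] [Fintype 𝒳] [DecidableEq V]
    (P : PMF (V → 𝒳)) (a : V) (k : ℕ) (α β : ℝ) : Prop where
  /-- There is a unique optimal EC, and the score of every other EC is smaller by at least `β`. -/
  gap : ∃ E, IsOptimalEC P k E ∧ (∀ E', IsOptimalEC P k E' → E' = E) ∧
    ∀ E' ∈ ecs V k, E' ≠ E → ∀ G ∈ E', score P G ≤ optScore P k - β
  /-- `X_a` has no children in any of the graphs in the optimal EC. -/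
  childless : ∀ E, IsOptimalEC P k E → ∀ G ∈ E, ∀ j, a ∉ G.pa j
  /-- The entropy of `X_a` given all the other variables is `α`. -/
  entropy : familyEntropy P a (Finset.univ.erase a) = α

/-- The joint law of `(X_v)_{v ∈ V}` and a noisy copy `X_b` of `X_a`, where `b = none`: the
variables `X_v`, `v ∈ V`, have law `P`; the hidden coin `C` has law `coin` and is independent of
them; if `C = 1` then `X_b = X_a`, and if `C = 0` then `X_b` has law `ν` and is independent of
the variables `X_v`, `v ∈ V`. -/
noncomputable def noisyCopy {V 𝒳 : Type*} (P : PMF (V → 𝒳)) (a : V) (ν : PMF 𝒳)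
    (coin : PMF Bool) : PMF (Option V → 𝒳) :=
  P.bind fun x => coin.bind fun c =>
    (if c then PMF.pure (x a) else ν).map fun y => fun o : Option V => o.elim y x

/-- The noise level `max (H(X_b ∣ X_a), H(X_a ∣ X_b))`, where `b = none`. -/
noncomputable def noiseLevel {V 𝒳 : Type*} [Fintype 𝒳] (Q : PMF (Option V → 𝒳)) (a : V) : ℝ :=
  max (condEntropy Q (fun x => x none) (fun x => x (some a)))
    (condEntropy Q (fun x => x (some a)) (fun x => x none))

end BayesNet

namespace BayesNet

/-! Write `H` for entropies under the noisy copy law and take `λ = ε/2`. Start from an optimal graph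
`G` for `P`, where `X_a` is childless with parents `Π`. Adding `X_b` as a child of `X_a` gives `G₁`,
with score `score P G - H(b ∣ a)`. Letting `X_b` inherit `Π` and making `X_b` the only parent of
`X_a` gives `G₂`, with score `score P G - H(b ∣ a) - H(a ∣ b) + H(a ∣ b, Π)`. The class of `G₂` is
the near-optimal one.

Near-optimality: identifying `X_b` with `X_a` in any graph on `Option V` gives a graph on `V`, and
this costs at most `H(a ∣ b)`. Hence the optimal score is at most `score P G - H(b ∣ a) + H(a ∣ b)`
(`exists_score_le_merge`), and `G₂` misses it by at most `2 H(a ∣ b) ≤ 2λ = ε`.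

Non-optimality: `G₂` scores strictly less than `G₁` unless `H(a ∣ b, Π) = H(a ∣ b)`. This equality
says that `X_a` and `Π` are independent given `X_b`; as the copy is properly noisy, they would then
be independent outright (`familyEntropy_eq_of_noisyCopy_eq`). But then `X_a` could be made a root
and the parent of another root without loss of score, so a graph outside the optimal class would be
optimal (`IsBase.familyEntropy_ne`).

A suitable coin exists by the intermediate value theorem. The bounds extend from `G₂` to its class
because Markov equivalent graphs have equal scores. That follows from Gibbs' inequality
(`condEntropy_gibbs`) applied to the projection of `P` on the distributions generated by one of the
graphs. -/

/-! ### Laws, conditional entropy and Gibbs' inequality. -/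

theorem ite_iff_congr {α : Type*} {p q : Prop} {_ : Decidable p} {_ : Decidable q} (h : p ↔ q)
    (a b : α) : (if p then a else b) = if q then a else b := by
  by_cases hq : q
  · rw [if_pos hq, if_pos (h.2 hq)]
  · rw [if_neg hq, if_neg (mt h.1 hq)]

/-- The real-valued law of the random variable `f`. -/
noncomputable def law {Ω A : Type*} (P : PMF Ω) (f : Ω → A) (a : A) : ℝ := (P.map f a).toReal

open Classical in
theorem law_eq_sum {Ω A : Type*} [Fintype Ω] (P : PMF Ω) (f : Ω → A) (a : A) :
    law P f a = ∑ ω, if f ω = a then (P ω).toReal else 0 := by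
  rw [law, PMF.map_apply, tsum_fintype, ENNReal.toReal_sum]
  · refine Finset.sum_congr rfl fun ω _ => ?_
    by_cases h : f ω = a
    · simp [h]
    · simp [h, Ne.symm h]
  · intro ω _
    split_ifs
    · exact P.apply_ne_top ω
    · simp

theorem law_nonneg {Ω A : Type*} (P : PMF Ω) (f : Ω → A) (a : A) : 0 ≤ law P f a :=
  ENNReal.toReal_nonneg

theorem sum_law_mul {Ω A : Type*} [Fintype Ω] [Fintype A] (P : PMF Ω) (f : Ω → A) (F : A → ℝ) :
    ∑ a, law P f a * F a = ∑ ω, (P ω).toReal * F (f ω) := by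
  classical
  simp_rw [law_eq_sum, Finset.sum_mul]
  rw [Finset.sum_comm]
  refine Finset.sum_congr rfl fun ω _ => ?_
  simp

theorem sum_toReal {Ω : Type*} [Fintype Ω] (P : PMF Ω) : ∑ ω, (P ω).toReal = 1 := by
  rw [← ENNReal.toReal_sum (fun ω _ => P.apply_ne_top ω), ← tsum_fintype (L := .unconditional _),
    P.tsum_coe, ENNReal.toReal_one]

theorem sum_law_fst {Ω A B : Type*} [Fintype Ω] [Fintype A] (P : PMF Ω) (f : Ω → A)
    (g : Ω → B) (b : B) : ∑ a, law P (fun ω => (f ω, g ω)) (a, b) = law P g b := by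
  classical
  simp_rw [law_eq_sum]
  rw [Finset.sum_comm]
  refine Finset.sum_congr rfl fun ω _ => ?_
  by_cases h : g ω = b <;> simp [h]

theorem law_pair_le {Ω A B : Type*} [Fintype Ω] [Fintype A] (P : PMF Ω) (f : Ω → A)
    (g : Ω → B) (a : A) (b : B) : law P (fun ω => (f ω, g ω)) (a, b) ≤ law P g b := by
  rw [← sum_law_fst P f g b]
  exact Finset.single_le_sum (f := fun a => law P (fun ω => (f ω, g ω)) (a, b))
    (fun _ _ => law_nonneg _ _ _) (Finset.mem_univ a)

theorem condEntropy_eq_sum_log {Ω A B : Type*} [Fintype Ω] [Fintype A] [Fintype B]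
    (P : PMF Ω) (f : Ω → A) (g : Ω → B) :
    condEntropy P f g = ∑ b, ∑ a, -(law P (fun ω => (f ω, g ω)) (a, b) *
      (Real.log (law P (fun ω => (f ω, g ω)) (a, b)) - Real.log (law P g b))) := by
  unfold condEntropy
  refine Finset.sum_congr rfl fun b _ => ?_
  rw [Finset.mul_sum]
  refine Finset.sum_congr rfl fun a _ => ?_
  change law P g b * Real.negMulLog (law P (fun ω => (f ω, g ω)) (a, b) / law P g b) = _
  have h1 := law_nonneg P (fun ω => (f ω, g ω)) (a, b)
  have h2 := law_pair_le P f g a b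
  rcases h1.eq_or_lt with h | h
  · simp [← h]
  · have h3 : 0 < law P g b := h.trans_le h2
    rw [Real.negMulLog, Real.log_div h.ne' h3.ne']
    field_simp

theorem condEntropy_eq_sub {Ω A B : Type*} [Fintype Ω] [Fintype A] [Fintype B]
    (P : PMF Ω) (f : Ω → A) (g : Ω → B) :
    condEntropy P f g = ∑ b, ∑ a, Real.negMulLog (law P (fun ω => (f ω, g ω)) (a, b)) -
      ∑ b, Real.negMulLog (law P g b) := by
  rw [condEntropy_eq_sum_log, ← Finset.sum_sub_distrib]
  refine Finset.sum_congr rfl fun b _ => ?_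
  rw [show Real.negMulLog (law P g b) = ∑ a, -(law P (fun ω => (f ω, g ω)) (a, b) *
    Real.log (law P g b)) by
      rw [Finset.sum_neg_distrib, ← Finset.sum_mul, sum_law_fst, Real.negMulLog]; ring,
    ← Finset.sum_sub_distrib]
  refine Finset.sum_congr rfl fun a _ => ?_
  rw [Real.negMulLog]; ring

theorem sum_law_pair_mul {Ω A B : Type*} [Fintype Ω] [Fintype A] [Fintype B]
    (P : PMF Ω) (f : Ω → A) (g : Ω → B) (F : A → B → ℝ) :
    ∑ b, ∑ a, law P (fun ω => (f ω, g ω)) (a, b) * F a b =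
      ∑ ω, (P ω).toReal * F (f ω) (g ω) := by
  rw [← sum_law_mul P (fun ω => (f ω, g ω)) (fun ab => F ab.1 ab.2), Fintype.sum_prod_type_right]

theorem condEntropy_eq_expect {Ω A B : Type*} [Fintype Ω] [Fintype A] [Fintype B]
    (P : PMF Ω) (f : Ω → A) (g : Ω → B) :
    condEntropy P f g = -∑ ω, (P ω).toReal *
      (Real.log (law P (fun ω => (f ω, g ω)) (f ω, g ω)) - Real.log (law P g (g ω))) := by
  rw [condEntropy_eq_sum_log, ← sum_law_pair_mul P f g (fun a b =>
    Real.log (law P (fun ω => (f ω, g ω)) (a, b)) - Real.log (law P g b))]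
  simp only [Finset.sum_neg_distrib]

/-- This is `log t ≤ t - 1` at `t = s κ / r`, multiplied by `r`; strictness for `t ≠ 1` gives the
equality case. It is the pointwise form of Gibbs' inequality. -/
theorem mul_log_div_le {r s κ : ℝ} (hr : 0 ≤ r) (hs : 0 ≤ s) (hκ : 0 ≤ κ)
    (hpos : 0 < r → 0 < s ∧ 0 < κ) :
    -(r * (Real.log r - Real.log s)) + r * Real.log κ ≤ s * κ - r ∧
    (-(r * (Real.log r - Real.log s)) + r * Real.log κ = s * κ - r → r = s * κ) := by
  rcases hr.eq_or_lt with h | h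
  · subst h
    simp only [zero_mul, neg_zero, zero_add, sub_zero]
    exact ⟨by positivity, id⟩
  · obtain ⟨h1, h2⟩ := hpos h
    have e : -(r * (Real.log r - Real.log s)) + r * Real.log κ = r * Real.log (s * κ / r) := by
      rw [Real.log_div (by positivity) h.ne', Real.log_mul h1.ne' h2.ne']; ring
    have e2 : s * κ - r = r * (s * κ / r - 1) := by field_simp
    rw [e, e2]
    refine ⟨mul_le_mul_of_nonneg_left (Real.log_le_sub_one_of_pos (by positivity)) hr, fun h3 => ?_⟩
    by_contra hne
    have := Real.log_lt_sub_one_of_pos (x := s * κ / r) (by positivity)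
      (fun h4 => hne (by field_simp at h4; exact h4.symm))
    exact (mul_lt_mul_of_pos_left this h).ne h3

/-- Gibbs' inequality for conditional laws, with its equality case. -/
theorem condEntropy_gibbs {Ω A B : Type*} [Fintype Ω] [Fintype A] [Fintype B]
    (P : PMF Ω) (f : Ω → A) (g : Ω → B) (κ : B → A → ℝ) (h0 : ∀ b a, 0 ≤ κ b a)
    (h1 : ∀ b, ∑ a, κ b a ≤ 1) (hpos : ∀ ω, P ω ≠ 0 → 0 < κ (g ω) (f ω)) :
    condEntropy P f g ≤ -∑ ω, (P ω).toReal * Real.log (κ (g ω) (f ω)) ∧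
    (condEntropy P f g = -∑ ω, (P ω).toReal * Real.log (κ (g ω) (f ω)) →
      ∀ a b, law P (fun ω => (f ω, g ω)) (a, b) = law P g b * κ b a) := by
  classical
  set r := law P (fun ω => (f ω, g ω)) with hr
  have key : ∀ a b, 0 < r (a, b) → 0 < law P g b ∧ 0 < κ b a := by
    intro a b h
    refine ⟨h.trans_le (law_pair_le P f g a b), ?_⟩
    rw [hr, law_eq_sum] at h
    obtain ⟨ω, -, hω⟩ := Finset.exists_ne_zero_of_sum_ne_zero h.ne'
    split_ifs at hω with h2
    · simp only [Prod.mk.injEq] at h2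
      rw [← h2.1, ← h2.2]
      exact hpos ω (fun h3 => hω (by simp [h3]))
    · exact absurd rfl hω
  have e : condEntropy P f g + ∑ ω, (P ω).toReal * Real.log (κ (g ω) (f ω)) =
      ∑ b, ∑ a, (-(r (a, b) * (Real.log (r (a, b)) - Real.log (law P g b))) +
        r (a, b) * Real.log (κ b a)) := by
    rw [condEntropy_eq_sum_log, ← sum_law_pair_mul P f g (fun a b => Real.log (κ b a)),
      ← Finset.sum_add_distrib]
    refine Finset.sum_congr rfl fun b _ => ?_
    rw [← Finset.sum_add_distrib]
  have hle := fun a b => mul_log_div_le (law_nonneg P (fun ω => (f ω, g ω)) (a, b))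
    (law_nonneg P g b) (h0 b a) (key a b)
  -- A subprobability kernel suffices here. This matters because the kernels used later are
  -- quotients of laws, which vanish identically at null values of `g`.
  have hs : ∑ b, ∑ a, (law P g b * κ b a - r (a, b)) ≤ 0 := by
    refine Finset.sum_nonpos fun b _ => ?_
    rw [Finset.sum_sub_distrib, ← Finset.mul_sum, hr, sum_law_fst]
    nlinarith [h1 b, law_nonneg P g b]
  have hs2 : ∀ b ∈ Finset.univ, ∑ a, (-(r (a, b) * (Real.log (r (a, b)) - Real.log (law P g b))) +
        r (a, b) * Real.log (κ b a)) ≤ ∑ a, (law P g b * κ b a - r (a, b)) :=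
    fun b _ => Finset.sum_le_sum fun a _ => (hle a b).1
  constructor
  · linarith [Finset.sum_le_sum hs2]
  · intro heq a b
    -- Equality of the totals forces equality in every summand, first over `b`, then over `a`.
    have e3 := le_antisymm (Finset.sum_le_sum hs2) (by linarith)
    have e4 := (Finset.sum_eq_sum_iff_of_le hs2).1 e3 b (Finset.mem_univ b)
    have e5 := (Finset.sum_eq_sum_iff_of_le (fun a _ => (hle a b).1)).1 e4 a (Finset.mem_univ a)
    exact (hle a b).2 e5

/-! ### Marginals on sets of coordinates -/

section Marginals

variable {V 𝒳 : Type*} [Fintype V] [DecidableEq V] [Fintype 𝒳]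

open Classical in
/-- The marginal of `p` on the coordinates in `S`, evaluated at the restriction of `x` to `S`. -/
noncomputable def marg (p : (V → 𝒳) → ℝ) (S : Finset V) (x : V → 𝒳) : ℝ :=
  ∑ y, if ∀ j ∈ S, y j = x j then p y else 0

/-- The entropy of the coordinates in `S`. -/
noncomputable def ent (P : PMF (V → 𝒳)) (S : Finset V) : ℝ :=
  -∑ x, (P x).toReal * Real.log (marg (fun y => (P y).toReal) S x)

theorem marg_congr (p : (V → 𝒳) → ℝ) {S : Finset V} {x x' : V → 𝒳} (h : ∀ j ∈ S, x j = x' j) :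
    marg p S x = marg p S x' := by
  unfold marg
  refine Finset.sum_congr rfl fun y _ => ?_
  have : (∀ j ∈ S, y j = x j) ↔ ∀ j ∈ S, y j = x' j :=
    forall₂_congr fun j hj => by rw [h j hj]
  exact ite_iff_congr this _ _

theorem marg_nonneg {p : (V → 𝒳) → ℝ} (hp : ∀ x, 0 ≤ p x) (S : Finset V) (x : V → 𝒳) :
    0 ≤ marg p S x :=
  Finset.sum_nonneg fun y _ => by split_ifs <;> simp [hp]

theorem marg_anti {p : (V → 𝒳) → ℝ} (hp : ∀ x, 0 ≤ p x) {S T : Finset V} (h : S ⊆ T)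
    (x : V → 𝒳) : marg p T x ≤ marg p S x := by
  refine Finset.sum_le_sum fun y _ => ?_
  by_cases h1 : ∀ j ∈ T, y j = x j
  · rw [if_pos h1, if_pos fun j hj => h1 j (h hj)]
  · rw [if_neg h1]; split_ifs <;> simp [hp]

theorem marg_univ (p : (V → 𝒳) → ℝ) (x : V → 𝒳) : marg p Finset.univ x = p x := by
  classical
  unfold marg
  rw [← Fintype.sum_ite_eq x p]
  exact Finset.sum_congr rfl fun y _ => ite_iff_congr (by simp [funext_iff, eq_comm]) _ _

theorem marg_empty (p : (V → 𝒳) → ℝ) (x : V → 𝒳) : marg p ∅ x = ∑ y, p y := by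
  simp [marg]

theorem le_marg {p : (V → 𝒳) → ℝ} (hp : ∀ x, 0 ≤ p x) (S : Finset V) (x : V → 𝒳) :
    p x ≤ marg p S x := by
  rw [← marg_univ p x]
  exact marg_anti hp (Finset.subset_univ S) x

theorem marg_eq_sum_update (p : (V → 𝒳) → ℝ) {S : Finset V} {i : V} (hi : i ∉ S) (x : V → 𝒳) :
    marg p S x = ∑ v, marg p (insert i S) (Function.update x i v) := by
  classical
  unfold marg
  rw [Finset.sum_comm]
  refine Finset.sum_congr rfl fun y _ => ?_
  have : ∀ v, (∀ j ∈ insert i S, y j = Function.update x i v j) ↔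
      v = y i ∧ ∀ j ∈ S, y j = x j := by
    intro v
    rw [Finset.forall_mem_insert, Function.update_self, eq_comm]
    refine and_congr_right fun _ => forall₂_congr fun j hj => ?_
    rw [Function.update_of_ne (by rintro rfl; exact hi hj)]
  trans ∑ v, if v = y i ∧ ∀ j ∈ S, y j = x j then p y else 0
  · by_cases h : ∀ j ∈ S, y j = x j
    · rw [if_pos h]; simp +contextual [h]
    · rw [if_neg h]; simp +contextual [h]
  · exact Finset.sum_congr rfl fun v _ => ite_iff_congr (this v).symm _ _

theorem law_family_eq_marg (P : PMF (V → 𝒳)) (i : V) (S : Finset V) (x : V → 𝒳) :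
    law P (fun x => (x i, fun j : S => x j)) (x i, fun j : S => x j) =
      marg (fun y => (P y).toReal) (insert i S) x := by
  classical
  rw [law_eq_sum, marg]
  refine Finset.sum_congr rfl fun y _ => ?_
  have : (y i, fun j : S => y j) = (x i, fun j : S => x j) ↔ ∀ j ∈ insert i S, y j = x j := by
    simp [funext_iff]
  exact ite_iff_congr this _ _

theorem law_restrict_eq_marg (P : PMF (V → 𝒳)) (S : Finset V) (x : V → 𝒳) :
    law P (fun x (j : S) => x j) (fun j : S => x j) = marg (fun y => (P y).toReal) S x := by
  classical
  rw [law_eq_sum, marg]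
  refine Finset.sum_congr rfl fun y _ => ?_
  have : (fun j : S => y j) = (fun j : S => x j) ↔ ∀ j ∈ S, y j = x j := by
    simp [funext_iff]
  exact ite_iff_congr this _ _

theorem familyEntropy_eq_expect (P : PMF (V → 𝒳)) (i : V) (S : Finset V) :
    familyEntropy P i S = -∑ x, (P x).toReal *
      (Real.log (marg (fun y => (P y).toReal) (insert i S) x) -
        Real.log (marg (fun y => (P y).toReal) S x)) := by
  rw [familyEntropy, condEntropy_eq_expect]
  simp only [law_family_eq_marg, law_restrict_eq_marg]

theorem familyEntropy_eq_ent (P : PMF (V → 𝒳)) (i : V) (S : Finset V) :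
    familyEntropy P i S = ent P (insert i S) - ent P S := by
  rw [familyEntropy_eq_expect, ent, ent]
  simp only [mul_sub, Finset.sum_sub_distrib]
  ring

theorem condEntropy_eq_familyEntropy (P : PMF (V → 𝒳)) (i j : V) :
    condEntropy P (fun x => x i) (fun x => x j) = familyEntropy P i {j} := by
  classical
  rw [familyEntropy_eq_expect, condEntropy_eq_expect]
  congr 1
  refine Finset.sum_congr rfl fun x _ => ?_
  congr 3
  · rw [law_eq_sum, marg]
    refine Finset.sum_congr rfl fun y _ => ?_
    simp
  · rw [law_eq_sum, marg]
    refine Finset.sum_congr rfl fun y _ => ?_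
    simp

theorem familyEntropy_nonneg (P : PMF (V → 𝒳)) (i : V) (S : Finset V) :
    0 ≤ familyEntropy P i S := by
  rw [familyEntropy_eq_expect, ← Finset.sum_neg_distrib]
  refine Finset.sum_nonneg fun x _ => ?_
  have hp : ∀ x, 0 ≤ (P x).toReal := fun _ => ENNReal.toReal_nonneg
  rcases (hp x).eq_or_lt with h | h
  · simp [← h]
  · have := Real.log_le_log (h.trans_le (le_marg hp (insert i S) x))
      (marg_anti hp (Finset.subset_insert i S) x)
    nlinarith

theorem toReal_pos_of_ne_zero {Ω : Type*} (P : PMF Ω) {ω : Ω} (h : P ω ≠ 0) : 0 < (P ω).toReal :=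
  ENNReal.toReal_pos h (P.apply_ne_top ω)

/-- Conditioning on more variables decreases the entropy; equality means conditional
independence. -/
theorem familyEntropy_anti_and_eq (P : PMF (V → 𝒳)) {i : V} {S T : Finset V} (h : S ⊆ T) :
    familyEntropy P i T ≤ familyEntropy P i S ∧
    (familyEntropy P i T = familyEntropy P i S → ∀ x,
      marg (fun y => (P y).toReal) (insert i T) x * marg (fun y => (P y).toReal) S x =
      marg (fun y => (P y).toReal) (insert i S) x * marg (fun y => (P y).toReal) T x) := by
  have hp : ∀ x, 0 ≤ (P x).toReal := fun _ => ENNReal.toReal_nonneg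
  -- The conditional law of `X_i` given `X_S`, read as a kernel on `X_T`; Gibbs' inequality against
  -- it compares the two entropies.
  let κ : (T → 𝒳) → 𝒳 → ℝ := fun u v =>
    law P (fun x => (x i, fun j : S => x j)) (v, fun j : S => u ⟨j, h j.2⟩) /
      law P (fun x (j : S) => x j) (fun j : S => u ⟨j, h j.2⟩)
  have hκ : ∀ x : V → 𝒳, κ (fun j : T => x j) (x i) =
      marg (fun y => (P y).toReal) (insert i S) x / marg (fun y => (P y).toReal) S x := by
    intro x
    rw [← law_family_eq_marg, ← law_restrict_eq_marg]
  have e : -∑ x, (P x).toReal * Real.log (κ (fun j : T => x j) (x i)) = familyEntropy P i S := by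
    rw [familyEntropy_eq_expect]
    congr 1
    refine Finset.sum_congr rfl fun x _ => ?_
    rcases (hp x).eq_or_lt with h1 | h1
    · simp [← h1]
    · rw [hκ, Real.log_div (h1.trans_le (le_marg hp _ x)).ne' (h1.trans_le (le_marg hp _ x)).ne']
  obtain ⟨g1, g2⟩ := condEntropy_gibbs P (fun x => x i) (fun x (j : T) => x j) κ
    (fun u v => div_nonneg (law_nonneg _ _ _) (law_nonneg _ _ _))
    (fun u => by
      simp only [κ]
      rw [← Finset.sum_div, sum_law_fst P (fun x => x i) (fun x (j : S) => x j)]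
      exact div_self_le_one _)
    (fun x hx => by
      rw [hκ]
      have h1 := toReal_pos_of_ne_zero P hx
      exact div_pos (h1.trans_le (le_marg hp _ x)) (h1.trans_le (le_marg hp _ x)))
  rw [e] at g1 g2
  refine ⟨g1, fun heq x => ?_⟩
  have := g2 heq (x i) (fun j : T => x j)
  rw [hκ, law_family_eq_marg, law_restrict_eq_marg] at this
  rw [this]
  by_cases hz : marg (fun y => (P y).toReal) S x = 0
  · have h1 : marg (fun y => (P y).toReal) (insert i S) x = 0 :=
      le_antisymm (hz ▸ marg_anti hp (Finset.subset_insert i S) x) (marg_nonneg hp _ x)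
    simp [hz, h1]
  · field_simp

theorem familyEntropy_anti (P : PMF (V → 𝒳)) {i : V} {S T : Finset V} (h : S ⊆ T) :
    familyEntropy P i T ≤ familyEntropy P i S :=
  (familyEntropy_anti_and_eq P h).1

theorem familyEntropy_of_indep (P : PMF (V → 𝒳)) {i : V} {S : Finset V}
    (h : ∀ x, marg (fun y => (P y).toReal) (insert i S) x =
      marg (fun y => (P y).toReal) {i} x * marg (fun y => (P y).toReal) S x) :
    familyEntropy P i S = familyEntropy P i ∅ := by
  have hp : ∀ x, 0 ≤ (P x).toReal := fun _ => ENNReal.toReal_nonneg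
  rw [familyEntropy_eq_expect, familyEntropy_eq_expect]
  congr 1
  refine Finset.sum_congr rfl fun x _ => ?_
  rcases (hp x).eq_or_lt with h1 | h1
  · simp [← h1]
  · rw [h, marg_empty, sum_toReal, Real.log_mul (h1.trans_le (le_marg hp _ x)).ne'
      (h1.trans_le (le_marg hp _ x)).ne']
    simp

end Marginals

/-! ### The law of the noisy copy -/

section NoisyCopy

variable {V 𝒳 : Type*} [Fintype V] [DecidableEq V] [Fintype 𝒳]

open Classical in
/-- The conditional law of the noisy copy, when the copy is exact with probability `t`. -/
noncomputable def copyKernel (t : ℝ) (ν : PMF 𝒳) (u v : 𝒳) : ℝ :=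
  t * (if u = v then 1 else 0) + (1 - t) * (ν v).toReal

theorem sum_copyKernel (t : ℝ) (ν : PMF 𝒳) (u : 𝒳) : ∑ v, copyKernel t ν u v = 1 := by
  unfold copyKernel
  rw [Finset.sum_add_distrib, ← Finset.mul_sum, ← Finset.mul_sum, sum_toReal,
    Finset.sum_eq_single u (fun v _ h => if_neg h.symm) (by simp), if_pos rfl]
  ring

omit [Fintype V] [DecidableEq V] [Fintype 𝒳] in
theorem map_optionElim_apply (μ : PMF 𝒳) (x : V → 𝒳) (y : Option V → 𝒳) [Decidable (x = y ∘ some)] :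
    μ.map (fun v => fun o : Option V => o.elim v x) y = if x = y ∘ some then μ (y none) else 0 := by
  classical
  rw [PMF.map_apply]
  split_ifs with h
  · rw [tsum_eq_single (y none)]
    · rw [if_pos]
      ext o
      cases o <;> simp [h]
    · intro v hv
      rw [if_neg]
      intro h2
      exact hv (by simp [h2])
  · rw [ENNReal.tsum_eq_zero]
    intro v
    rw [if_neg]
    intro h2
    exact h (by ext i; simp [h2])

theorem coin_false_toReal (coin : PMF Bool) : (coin false).toReal = 1 - (coin true).toReal := by
  have := sum_toReal coin
  rw [Fintype.sum_bool] at this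
  linarith

theorem noisyCopy_apply (P : PMF (V → 𝒳)) (a : V) (ν : PMF 𝒳) (coin : PMF Bool)
    (y : Option V → 𝒳) : (noisyCopy P a ν coin y).toReal =
      (P (y ∘ some)).toReal * copyKernel (coin true).toReal ν (y (some a)) (y none) := by
  classical
  have h : ∀ x : V → 𝒳, ((coin.bind fun c =>
      (if c then PMF.pure (x a) else ν).map fun v => fun o : Option V => o.elim v x) y) =
      if x = y ∘ some then coin true * (if x a = y none then 1 else 0) + coin false * ν (y none)
        else 0 := by
    intro x
    rw [PMF.bind_apply, tsum_fintype, Fintype.sum_bool]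
    simp only [map_optionElim_apply]
    by_cases h : x = y ∘ some
    · simp [h, PMF.pure_apply, eq_comm]
    · simp [h]
  rw [noisyCopy, PMF.bind_apply, tsum_fintype]
  simp only [h]
  rw [Finset.sum_eq_single (y ∘ some) (by intro x _ hx; simp [hx]) (by simp), if_pos rfl,
    ENNReal.toReal_mul, ENNReal.toReal_add, ENNReal.toReal_mul, ENNReal.toReal_mul,
    coin_false_toReal, copyKernel]
  · congr 2
    by_cases h : y (some a) = y none <;> simp [h]
  · exact ENNReal.mul_ne_top (coin.apply_ne_top _) (by split_ifs <;> simp)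
  · exact ENNReal.mul_ne_top (coin.apply_ne_top _) (ν.apply_ne_top _)

theorem sum_option_pi (F : (Option V → 𝒳) → ℝ) :
    ∑ y, F y = ∑ x : V → 𝒳, ∑ v : 𝒳, F (fun o => o.elim v x) := by
  rw [← Fintype.sum_prod_type' (f := fun (x : V → 𝒳) (v : 𝒳) => F (fun o => o.elim v x))]
  refine Fintype.sum_equiv
    { toFun := fun y => (y ∘ some, y none)
      invFun := fun p o => o.elim p.2 p.1
      left_inv := fun y => by ext o; cases o <;> rfl
      right_inv := fun p => rfl } _ _ fun y => ?_
  congr 1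
  ext o
  cases o <;> rfl

theorem sum_noisyCopy_mul (P : PMF (V → 𝒳)) (a : V) (ν : PMF 𝒳) (coin : PMF Bool)
    (F : (V → 𝒳) → ℝ) : ∑ y, (noisyCopy P a ν coin y).toReal * F (y ∘ some) =
      ∑ x, (P x).toReal * F x := by
  rw [sum_option_pi]
  refine Finset.sum_congr rfl fun x _ => ?_
  have : ∀ v, (noisyCopy P a ν coin fun o => o.elim v x).toReal * F ((fun o => o.elim v x) ∘ some) =
      ((P x).toReal * F x) * copyKernel (coin true).toReal ν (x a) v := by
    intro v
    rw [noisyCopy_apply]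
    change (P x).toReal * copyKernel (coin true).toReal ν (x a) v * F x = _
    ring
  simp only [this]
  rw [← Finset.mul_sum, sum_copyKernel, mul_one]

theorem marg_noisyCopy_map_some (P : PMF (V → 𝒳)) (a : V) (ν : PMF 𝒳) (coin : PMF Bool)
    (S : Finset V) (y : Option V → 𝒳) :
    marg (fun y => (noisyCopy P a ν coin y).toReal) (S.map .some) y =
      marg (fun x => (P x).toReal) S (y ∘ some) := by
  classical
  have := sum_noisyCopy_mul P a ν coin (fun x => if ∀ j ∈ S, x j = (y ∘ some) j then 1 else 0)
  simp only [mul_ite, mul_one, mul_zero] at this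
  refine Eq.trans (Finset.sum_congr rfl fun z _ => ?_) (this.trans
    (Finset.sum_congr rfl fun z _ => ?_))
  · exact ite_iff_congr (by simp) _ _
  · exact ite_iff_congr Iff.rfl _ _

theorem marg_noisyCopy_insert_none (P : PMF (V → 𝒳)) {a : V} (ν : PMF 𝒳) (coin : PMF Bool)
    {S : Finset V} (ha : a ∈ S) (y : Option V → 𝒳) :
    marg (fun y => (noisyCopy P a ν coin y).toReal) (insert none (S.map .some)) y =
      marg (fun x => (P x).toReal) S (y ∘ some) *
        copyKernel (coin true).toReal ν (y (some a)) (y none) := by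
  classical
  unfold marg
  rw [sum_option_pi, Finset.sum_mul]
  refine Finset.sum_congr rfl fun x _ => ?_
  trans ∑ v, if v = y none then (if ∀ j ∈ S, x j = (y ∘ some) j then
    (P x).toReal * copyKernel (coin true).toReal ν (x a) v else 0) else 0
  · refine Finset.sum_congr rfl fun v _ => ?_
    simp only [noisyCopy_apply]
    rw [← ite_and]
    exact ite_iff_congr (by simp) _ _
  · rw [Finset.sum_ite_eq' Finset.univ (y none), if_pos (Finset.mem_univ _), ite_mul, zero_mul]
    by_cases h : ∀ j ∈ S, x j = (y ∘ some) j
    · rw [if_pos h, if_pos h, h a ha]; rfl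
    · rw [if_neg h, if_neg h]

/-- Sum over the value of `X_a`: the exact part of the kernel selects the value `y none`, and the
noise part does not depend on `X_a`. -/
theorem marg_noisyCopy_none (P : PMF (V → 𝒳)) {a : V} (ν : PMF 𝒳) (coin : PMF Bool)
    {S : Finset V} (ha : a ∉ S) (y : Option V → 𝒳) :
    marg (fun y => (noisyCopy P a ν coin y).toReal) (insert none (S.map .some)) y =
      (coin true).toReal * marg (fun x => (P x).toReal) (insert a S)
        (Function.update (y ∘ some) a (y none)) +
      (1 - (coin true).toReal) * (ν (y none)).toReal *
        marg (fun x => (P x).toReal) S (y ∘ some) := by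
  classical
  have h1 : some a ∉ insert none (S.map .some) := by simpa using ha
  have h2 : insert (some a) (insert none (S.map .some)) =
      insert none ((insert a S).map .some) := by
    ext o; cases o <;> simp
  rw [marg_eq_sum_update _ h1, h2, marg_eq_sum_update _ ha, Finset.mul_sum]
  have h3 : ∀ v, Function.update y (some a) v ∘ some = Function.update (y ∘ some) a v := by
    intro v; ext i
    by_cases h : i = a
    · subst h; simp
    · simp [h]
  simp only [marg_noisyCopy_insert_none P ν coin (Finset.mem_insert_self a S), h3, copyKernel,
    Function.update_self, ne_eq, reduceCtorEq, not_false_eq_true, Function.update_of_ne, mul_add,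
    Finset.sum_add_distrib]
  congr 1
  · simp [mul_comm]
  · exact Finset.sum_congr rfl fun v _ => by ring

theorem ent_noisyCopy_map_some (P : PMF (V → 𝒳)) (a : V) (ν : PMF 𝒳) (coin : PMF Bool)
    (S : Finset V) : ent (noisyCopy P a ν coin) (S.map .some) = ent P S := by
  unfold ent
  rw [← sum_noisyCopy_mul P a ν coin]
  simp only [marg_noisyCopy_map_some]

theorem noisyCopy_pos (P : PMF (V → 𝒳)) {a : V} {ν : PMF 𝒳} {coin : PMF Bool}
    {y : Option V → 𝒳} (h : 0 < (noisyCopy P a ν coin y).toReal) :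
    0 < (P (y ∘ some)).toReal ∧ 0 < copyKernel (coin true).toReal ν (y (some a)) (y none) := by
  rw [noisyCopy_apply] at h
  have h1 : 0 ≤ (P (y ∘ some)).toReal := ENNReal.toReal_nonneg
  have h2 := pos_of_mul_pos_right h h1
  exact ⟨h1.lt_of_ne fun h3 => by simp [← h3] at h, h2⟩

theorem ent_noisyCopy_insert_none (P : PMF (V → 𝒳)) {a : V} (ν : PMF 𝒳) (coin : PMF Bool)
    {S : Finset V} (ha : a ∈ S) : ent (noisyCopy P a ν coin) (insert none (S.map .some)) = ent P S -
      ∑ y, (noisyCopy P a ν coin y).toReal *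
        Real.log (copyKernel (coin true).toReal ν (y (some a)) (y none)) := by
  -- The correction term does not involve `S`, so it cancels in differences of entropies. This is
  -- how `X_a` screens `X_b` off from the other variables.
  rw [← ent_noisyCopy_map_some P a ν coin, ent, ent, ← neg_add', ← Finset.sum_add_distrib]
  congr 1
  refine Finset.sum_congr rfl fun y _ => ?_
  rcases (ENNReal.toReal_nonneg (a := noisyCopy P a ν coin y)).eq_or_lt with h | h
  · simp [← h]
  · obtain ⟨h1, h2⟩ := noisyCopy_pos P h
    rw [marg_noisyCopy_insert_none P ν coin ha, marg_noisyCopy_map_some, Real.log_mul _ h2.ne',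
      mul_add]
    exact (h1.trans_le (le_marg (fun _ => ENNReal.toReal_nonneg) S _)).ne'

/-- The noisy copy is independent of the other variables given the original. -/
theorem familyEntropy_noisyCopy_none (P : PMF (V → 𝒳)) {a : V} (ν : PMF 𝒳) (coin : PMF Bool)
    {S : Finset V} (ha : a ∈ S) : familyEntropy (noisyCopy P a ν coin) none (S.map .some) =
      familyEntropy (noisyCopy P a ν coin) none {some a} := by
  have h : ({some a} : Finset (Option V)) = ({a} : Finset V).map .some := by simp
  rw [h, familyEntropy_eq_ent, familyEntropy_eq_ent, ent_noisyCopy_insert_none P ν coin ha,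
    ent_noisyCopy_insert_none P ν coin (Finset.mem_singleton_self a), ent_noisyCopy_map_some,
    ent_noisyCopy_map_some]
  ring

theorem familyEntropy_noisyCopy_map_some (P : PMF (V → 𝒳)) (a : V) (ν : PMF 𝒳) (coin : PMF Bool)
    (i : V) (S : Finset V) : familyEntropy (noisyCopy P a ν coin) (some i) (S.map .some) =
      familyEntropy P i S := by
  have h : insert (some i) (S.map .some) = (insert i S).map .some := by simp
  rw [familyEntropy_eq_ent, h, ent_noisyCopy_map_some, ent_noisyCopy_map_some, familyEntropy_eq_ent]

theorem familyEntropy_noisyCopy_insert_none (P : PMF (V → 𝒳)) {a : V} (ν : PMF 𝒳)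
    (coin : PMF Bool) (i : V) {S : Finset V} (ha : a ∈ S) :
    familyEntropy (noisyCopy P a ν coin) (some i) (insert none (S.map .some)) =
      familyEntropy P i S := by
  have h : insert (some i) (insert none (S.map .some)) =
      insert none ((insert i S).map .some) := by
    ext o; cases o <;> simp
  rw [familyEntropy_eq_ent, h, ent_noisyCopy_insert_none P ν coin ha,
    ent_noisyCopy_insert_none P ν coin (Finset.mem_insert_of_mem ha), familyEntropy_eq_ent]
  ring

/-! ### The range of the noise level. -/

theorem noiseLevel_eq (Q : PMF (Option V → 𝒳)) (a : V) :
    noiseLevel Q a = max (familyEntropy Q none {some a}) (familyEntropy Q (some a) {none}) := by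
  rw [noiseLevel, condEntropy_eq_familyEntropy, condEntropy_eq_familyEntropy]

/-- If the coin always shows `0`, the noise level is at least the entropy of `X_a` given all
other variables. -/
theorem le_noiseLevel_of_coin_eq_zero (P : PMF (V → 𝒳)) (a : V) (ν : PMF 𝒳) {coin : PMF Bool}
    (h : coin true = 0) :
    familyEntropy P a (Finset.univ.erase a) ≤ noiseLevel (noisyCopy P a ν coin) a := by
  rw [noiseLevel_eq]
  refine le_max_of_le_right ?_
  -- Condition `X_a` on all other variables in addition to `X_b`; as `X_b` is now pure noise, it
  -- contributes nothing.
  refine le_trans (le_of_eq ?_) (familyEntropy_anti (T := insert none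
    ((Finset.univ.erase a).map .some)) _ (by simp))
  rw [familyEntropy_eq_expect, ← sum_noisyCopy_mul P a ν coin, familyEntropy_eq_expect]
  congr 1
  refine Finset.sum_congr rfl fun y _ => ?_
  rcases (ENNReal.toReal_nonneg (a := noisyCopy P a ν coin y)).eq_or_lt with h0 | h0
  · simp [← h0]
  obtain ⟨h1, h2⟩ := noisyCopy_pos P h0
  have hi : insert (some a) (insert none ((Finset.univ.erase a).map .some)) =
      insert none ((insert a (Finset.univ.erase a)).map .some) := by
    ext o; cases o <;> simp [em]
  rw [hi, marg_noisyCopy_insert_none P ν coin (Finset.mem_insert_self a _),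
    marg_noisyCopy_none P ν coin (Finset.notMem_erase a _)]
  have hp := fun S => (h1.trans_le (le_marg (fun _ => ENNReal.toReal_nonneg) S _)).ne'
  simp only [copyKernel, h, ENNReal.toReal_zero, zero_mul, sub_zero, one_mul, zero_add] at h2 ⊢
  rw [Real.log_mul (hp _) h2.ne', Real.log_mul h2.ne' (hp _)]
  ring_nf

theorem noiseLevel_of_coin_eq_one (P : PMF (V → 𝒳)) (a : V) (ν : PMF 𝒳) {coin : PMF Bool}
    (h : (coin true).toReal = 1) : noiseLevel (noisyCopy P a ν coin) a = 0 := by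
  classical
  have hs : ∀ y, noisyCopy P a ν coin y ≠ 0 → y none = y (some a) := by
    intro y hy
    obtain ⟨-, h2⟩ := noisyCopy_pos P (toReal_pos_of_ne_zero _ hy)
    by_contra hne
    simp [copyKernel, h, Ne.symm hne] at h2
  have hz : ∀ i j : Option V, (∀ y, noisyCopy P a ν coin y ≠ 0 → y i = y j) →
      condEntropy (noisyCopy P a ν coin) (fun x => x i) (fun x => x j) = 0 := by
    intro i j hij
    refine le_antisymm ?_ ?_
    · refine (condEntropy_gibbs (noisyCopy P a ν coin) (fun x => x i) (fun x => x j)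
        (fun u v => if u = v then 1 else 0) (fun u v => by split_ifs <;> simp)
        (fun u => by simp) (fun y hy => by simp [hij y hy])).1.trans (le_of_eq ?_)
      rw [neg_eq_zero]
      refine Finset.sum_eq_zero fun y _ => ?_
      split_ifs <;> simp
    · rw [condEntropy_eq_familyEntropy]
      exact familyEntropy_nonneg _ _ _
  rw [noiseLevel, hz _ _ hs, hz _ _ (fun y hy => (hs y hy).symm), max_self]

theorem exists_coin (t : ℝ) (h : t ∈ Set.Icc (0 : ℝ) 1) :
    ∃ coin : PMF Bool, (coin true).toReal = t := by
  refine ⟨PMF.ofFintype (fun c => if c then ENNReal.ofReal t else ENNReal.ofReal (1 - t)) ?_, ?_⟩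
  · rw [Fintype.sum_bool]
    simp only [if_true, Bool.false_eq_true, if_false]
    rw [← ENNReal.ofReal_add h.1 (by linarith [h.2])]
    simp
  · simp [ENNReal.toReal_ofReal h.1]

theorem exists_coin_noiseLevel_eq (P : PMF (V → 𝒳)) (a : V) (ν : PMF 𝒳) {l : ℝ} (h0 : 0 ≤ l)
    (hl : l ≤ familyEntropy P a (Finset.univ.erase a)) :
    ∃ coin : PMF Bool, noiseLevel (noisyCopy P a ν coin) a = l := by
  classical
  -- The weights of the noisy copy law as affine functions of a real `t`. With the entropy written
  -- through `Real.negMulLog`, which is continuous at `0`, there is no division by vanishing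
  -- probabilities and continuity in `t` is immediate.
  let w : ℝ → (Option V → 𝒳) → ℝ := fun t y =>
    (P (y ∘ some)).toReal * copyKernel t ν (y (some a)) (y none)
  let r : {A : Type _} → ((Option V → 𝒳) → A) → ℝ → A → ℝ := fun f t b =>
    ∑ y, if f y = b then w t y else 0
  have hw : ∀ y, Continuous fun t => w t y := fun y => by
    simp only [w, copyKernel]
    fun_prop
  have hr : ∀ {A : Type _} (f : (Option V → 𝒳) → A) (b : A), Continuous fun t => r f t b := by
    intro A f b
    refine continuous_finsetSum _ fun y _ => ?_
    split_ifs
    · exact hw y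
    · exact continuous_const
  let c : Option V → Option V → ℝ → ℝ := fun i j t =>
    ∑ b, ∑ u, Real.negMulLog (r (fun y => (y i, y j)) t (u, b)) -
      ∑ b, Real.negMulLog (r (fun y => y j) t b)
  have hc : ∀ i j, Continuous (c i j) := by
    intro i j
    refine Continuous.sub ?_ ?_
    · exact continuous_finsetSum _ fun b _ => continuous_finsetSum _ fun u _ =>
        Real.continuous_negMulLog.comp (hr _ _)
    · exact continuous_finsetSum _ fun b _ => Real.continuous_negMulLog.comp (hr _ _)
  let F : ℝ → ℝ := fun t => max (c none (some a) t) (c (some a) none t)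
  have hF : Continuous F := (hc _ _).max (hc _ _)
  have hcoin : ∀ coin : PMF Bool, noiseLevel (noisyCopy P a ν coin) a = F (coin true).toReal := by
    intro coin
    have hlaw : ∀ {A : Type _} (f : (Option V → 𝒳) → A) (b : A),
        law (noisyCopy P a ν coin) f b = r f (coin true).toReal b := by
      intro A f b
      rw [law_eq_sum]
      refine Finset.sum_congr rfl fun y _ => ?_
      rw [noisyCopy_apply]
    simp only [noiseLevel, condEntropy_eq_sub, hlaw]
    rfl
  obtain ⟨c0, hc0⟩ := exists_coin 0 (by simp)
  obtain ⟨c1, hc1⟩ := exists_coin 1 (by simp)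
  have e0 : familyEntropy P a (Finset.univ.erase a) ≤ F 0 := by
    rw [← hc0, ← hcoin]
    refine le_noiseLevel_of_coin_eq_zero P a ν ?_
    rcases (ENNReal.toReal_eq_zero_iff _).1 hc0 with h | h
    · exact h
    · exact absurd h (c0.apply_ne_top _)
  have e1 : F 1 = 0 := by
    rw [← hc1, ← hcoin]
    exact noiseLevel_of_coin_eq_one P a ν hc1
  obtain ⟨t, ht, hFt⟩ := intermediate_value_Icc' zero_le_one hF.continuousOn
    (show l ∈ Set.Icc (F 1) (F 0) from ⟨e1.trans_le h0, hl.trans e0⟩)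
  obtain ⟨coin, rfl⟩ := exists_coin t ht
  exact ⟨coin, (hcoin coin).trans hFt⟩

end NoisyCopy

/-! ### Markov equivalent graphs have the same score -/

/-- The number of proper ancestors increases strictly along an edge `i → j`: ancestors of `i` are
ancestors of `j`, and `i` is an ancestor of `j` but not of itself. -/
theorem DAG.exists_rank {V : Type*} [Finite V] (G : DAG V) :
    ∃ r : V → ℕ, ∀ i j, i ∈ G.pa j → r i < r j := by
  refine ⟨fun v => {u | Relation.TransGen (fun i j => i ∈ G.pa j) u v}.ncard, fun i j h => ?_⟩
  refine Set.ncard_lt_ncard ⟨fun u hu => Relation.TransGen.tail hu h, fun hsub => ?_⟩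
    (Set.toFinite _)
  exact G.acyclic i (hsub (Relation.TransGen.single h))

section Markov

variable {V 𝒳 : Type*} [Fintype V] [DecidableEq V]

/-- A set of nodes that contains the parents of its members. -/
def DAG.IsAncestral (G : DAG V) (A : Finset V) : Prop :=
  ∀ i ∈ A, G.pa i ⊆ A

theorem DAG.IsAncestral.exists_next {G : DAG V} {A : Finset V}
    (h : A ≠ Finset.univ) : ∃ i, i ∉ A ∧ G.pa i ⊆ A := by
  obtain ⟨r, hr⟩ := G.exists_rank
  have hne : (Finset.univ \ A).Nonempty := by
    rw [Finset.sdiff_nonempty]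
    intro h2
    exact h (Finset.univ_subset_iff.1 h2)
  obtain ⟨i, hi, hmin⟩ := Finset.exists_min_image _ r hne
  refine ⟨i, (Finset.mem_sdiff.1 hi).2, fun j hj => ?_⟩
  by_contra hjA
  exact (hr j i hj).not_ge (hmin j (by simp [hjA]))

omit [Fintype V] in
theorem DAG.IsAncestral.insert {G : DAG V} {A : Finset V} (hA : G.IsAncestral A) {i : V}
    (hi : G.pa i ⊆ A) : G.IsAncestral (insert i A) := by
  intro j hj
  rcases Finset.mem_insert.1 hj with rfl | hj
  · exact hi.trans (Finset.subset_insert _ _)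
  · exact (hA j hj).trans (Finset.subset_insert _ _)

/-- Backward induction along a topological order. -/
theorem DAG.ancestral_induction (G : DAG V) {C : Finset V → Prop} (huniv : C Finset.univ)
    (hstep : ∀ A i, G.IsAncestral A → i ∉ A → G.pa i ⊆ A → C (insert i A) → C A) :
    ∀ A, G.IsAncestral A → C A := by
  suffices ∀ n, ∀ A : Finset V, Aᶜ.card = n → G.IsAncestral A → C A from
    fun A hA => this _ A rfl hA
  intro n
  induction n with
  | zero =>
    intro A hA _
    rw [Finset.card_eq_zero, Finset.compl_eq_empty_iff] at hA
    rwa [hA]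
  | succ n ih =>
    intro A hA hanc
    have hne : A ≠ Finset.univ := by
      rintro rfl
      simp at hA
    obtain ⟨i, hi, hpa⟩ := DAG.IsAncestral.exists_next (G := G) hne
    refine hstep A i hanc hi hpa (ih _ ?_ (hanc.insert hpa))
    rw [Finset.compl_insert, Finset.card_erase_of_mem (by simpa using hi), hA]
    rfl

variable [Fintype 𝒳]

/-- Outside an ancestral set the nodes can be summed out in reverse topological order, and each of
their conditional laws sums to one. -/
theorem marg_prod {G : DAG V} {c : V → (V → 𝒳) → ℝ}
    (hdep : ∀ i x x', (∀ j ∈ insert i (G.pa i), x j = x' j) → c i x = c i x')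
    (hsum : ∀ i x, ∑ v, c i (Function.update x i v) = 1) {A : Finset V} (hA : G.IsAncestral A) :
    ∀ x, marg (fun y => ∏ i, c i y) A x = ∏ i ∈ A, c i x := by
  refine G.ancestral_induction (C := fun A => ∀ x, marg (fun y => ∏ i, c i y) A x =
    ∏ i ∈ A, c i x) (fun x => marg_univ _ x) ?_ A hA
  intro A i hanc hi hpa ih x
  rw [marg_eq_sum_update _ hi]
  have : ∀ v, marg (fun y => ∏ i, c i y) (insert i A) (Function.update x i v) =
      c i (Function.update x i v) * ∏ j ∈ A, c j x := by
    intro v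
    rw [ih, Finset.prod_insert hi]
    congr 1
    refine Finset.prod_congr rfl fun j hj => hdep _ _ _ fun l hl => ?_
    rw [Function.update_of_ne]
    rintro rfl
    rcases Finset.mem_insert.1 hl with rfl | hl
    · exact hi hj
    · exact hi (hanc j hj hl)
  simp only [this]
  rw [← Finset.sum_mul, hsum, one_mul]

/-- The factor `c` depends only on `i` and its parents, so summing out any other coordinate of `A`
preserves the identity; this leads from `A` down to `B`. -/
theorem marg_insert_of_subset {w : (V → 𝒳) → ℝ} {G : DAG V} {i : V} {c : (V → 𝒳) → ℝ}
    (hdep : ∀ x x', (∀ j ∈ insert i (G.pa i), x j = x' j) → c x = c x') {A : Finset V}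
    (hi : i ∉ A) (hA : ∀ x, marg w (insert i A) x = c x * marg w A x) :
    ∀ n, ∀ B : Finset V, (A \ B).card = n → G.pa i ⊆ B → B ⊆ A →
      ∀ x, marg w (insert i B) x = c x * marg w B x := by
  intro n
  induction n with
  | zero =>
    intro B hB _ hBA
    rw [Finset.card_eq_zero, Finset.sdiff_eq_empty_iff_subset] at hB
    rwa [← hBA.antisymm hB] at hA
  | succ n ih =>
    intro B hB hpa hBA x
    obtain ⟨j, hj⟩ : (A \ B).Nonempty := Finset.card_pos.1 (by omega)
    obtain ⟨hjA, hjB⟩ := Finset.mem_sdiff.1 hj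
    have hji : j ≠ i := by
      rintro rfl
      exact hi hjA
    have ih' := ih (insert j B) (by
      rw [Finset.sdiff_insert, Finset.card_erase_of_mem hj, hB]; rfl)
      (hpa.trans (Finset.subset_insert _ _)) (Finset.insert_subset hjA hBA)
    rw [marg_eq_sum_update w (i := j) (S := insert i B) (by simp [hji, hjB]),
      marg_eq_sum_update w hjB, Finset.mul_sum]
    refine Finset.sum_congr rfl fun v _ => ?_
    rw [Finset.insert_comm, ih']
    congr 1
    refine hdep _ _ fun l hl => ?_
    rw [Function.update_of_ne]
    rintro rfl
    rcases Finset.mem_insert.1 hl with rfl | hl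
    · exact hji rfl
    · exact hjB (hpa hl)

/-- The ordered Markov property of a product of conditional laws. -/
theorem marg_prod_mul {G : DAG V} {c : V → (V → 𝒳) → ℝ}
    (hdep : ∀ i x x', (∀ j ∈ insert i (G.pa i), x j = x' j) → c i x = c i x')
    (hsum : ∀ i x, ∑ v, c i (Function.update x i v) = 1) {A : Finset V} (hA : G.IsAncestral A)
    {i : V} (hi : i ∉ A) (hpa : G.pa i ⊆ A) (x : V → 𝒳) :
    marg (fun y => ∏ i, c i y) (insert i A) x * marg (fun y => ∏ i, c i y) (G.pa i) x =
      marg (fun y => ∏ i, c i y) (insert i (G.pa i)) x * marg (fun y => ∏ i, c i y) A x := by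
  have h1 : ∀ x, marg (fun y => ∏ i, c i y) (insert i A) x =
      c i x * marg (fun y => ∏ i, c i y) A x := by
    intro x
    rw [marg_prod hdep hsum hA, marg_prod hdep hsum (hA.insert hpa), Finset.prod_insert hi]
  rw [h1, marg_insert_of_subset (hdep i) hi h1 _ (G.pa i) rfl subset_rfl hpa]
  ring

/-! ### Conditional independence as identities between marginals. -/

theorem law_triple_eq_marg (P : PMF (V → 𝒳)) (A B C : Finset V) (x : V → 𝒳) :
    law P (fun x => (fun j : A => x j, fun j : B => x j, fun j : C => x j))
      (fun j : A => x j, fun j : B => x j, fun j : C => x j) =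
      marg (fun y => (P y).toReal) (A ∪ B ∪ C) x := by
  classical
  rw [law_eq_sum, marg]
  refine Finset.sum_congr rfl fun y _ => ite_iff_congr ?_ _ _
  simp only [Prod.mk.injEq, funext_iff, Subtype.forall, Finset.mem_union]
  exact ⟨fun h j hj => by rcases hj with (hj | hj) | hj; exacts [h.1 j hj, h.2.1 j hj, h.2.2 j hj],
    fun h => ⟨fun j hj => h j (by simp [hj]), fun j hj => h j (by simp [hj]),
      fun j hj => h j (by simp [hj])⟩⟩

theorem law_two_eq_marg (P : PMF (V → 𝒳)) (A C : Finset V) (x : V → 𝒳) :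
    law P (fun x => (fun j : A => x j, fun j : C => x j)) (fun j : A => x j, fun j : C => x j) =
      marg (fun y => (P y).toReal) (A ∪ C) x := by
  classical
  rw [law_eq_sum, marg]
  refine Finset.sum_congr rfl fun y _ => ite_iff_congr ?_ _ _
  simp only [Prod.mk.injEq, funext_iff, Subtype.forall, Finset.mem_union]
  exact ⟨fun h j hj => hj.elim (h.1 j) (h.2 j),
    fun h => ⟨fun j hj => h j (Or.inl hj), fun j hj => h j (Or.inr hj)⟩⟩

theorem condIndep_iff_marg (P : PMF (V → 𝒳)) {A B C : Finset V} (hAB : Disjoint A B)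
    (hAC : Disjoint A C) (hBC : Disjoint B C) :
    CondIndep P (fun x (j : A) => x j) (fun x (j : B) => x j) (fun x (j : C) => x j) ↔
      ∀ x, marg (fun y => (P y).toReal) (A ∪ B ∪ C) x * marg (fun y => (P y).toReal) C x =
        marg (fun y => (P y).toReal) (A ∪ C) x * marg (fun y => (P y).toReal) (B ∪ C) x := by
  simp_rw [← law_triple_eq_marg, ← law_two_eq_marg, ← law_restrict_eq_marg, law,
    ← ENNReal.toReal_mul]
  simp_rw [ENNReal.toReal_eq_toReal_iff' (ENNReal.mul_ne_top (PMF.apply_ne_top _ _)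
    (PMF.apply_ne_top _ _)) (ENNReal.mul_ne_top (PMF.apply_ne_top _ _) (PMF.apply_ne_top _ _))]
  constructor
  · intro h x
    exact h _ _ _
  · intro h a b c
    obtain ⟨x0, -⟩ := P.support_nonempty
    -- Disjointness lets arbitrary values on the three sets be glued to one configuration; `x0` only
    -- fills the remaining coordinates.
    let x : V → 𝒳 := fun j => if h : j ∈ A then a ⟨j, h⟩ else if h : j ∈ B then b ⟨j, h⟩ else
      if h : j ∈ C then c ⟨j, h⟩ else x0 j
    have ea : (fun j : A => x j) = a := by
      ext ⟨j, hj⟩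
      simp [x, hj]
    have eb : (fun j : B => x j) = b := by
      ext ⟨j, hj⟩
      simp [x, hj, Finset.disjoint_right.1 hAB hj]
    have ec : (fun j : C => x j) = c := by
      ext ⟨j, hj⟩
      simp [x, hj, Finset.disjoint_right.1 hAC hj, Finset.disjoint_right.1 hBC hj]
    have := h x
    rwa [ea, eb, ec] at this

omit [Fintype V] [Fintype 𝒳] in
theorem kernel_congr {G : DAG V} (θ : ∀ i, (G.pa i → 𝒳) → PMF 𝒳) (i : V) (x x' : V → 𝒳)
    (h : ∀ j ∈ insert i (G.pa i), x j = x' j) :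
    (θ i (fun j => x j) (x i)).toReal = (θ i (fun j => x' j) (x' i)).toReal := by
  have h1 : (fun j : G.pa i => x j) = fun j : G.pa i => x' j :=
    funext fun j => h j (Finset.mem_insert_of_mem j.2)
  rw [h1, h i (Finset.mem_insert_self _ _)]

omit [Fintype V] [DecidableEq V] in
theorem DAG.notMem_pa_self (G : DAG V) (i : V) : i ∉ G.pa i :=
  fun h => G.acyclic i (Relation.TransGen.single h)

omit [Fintype V] in
theorem sum_kernel {G : DAG V} (θ : ∀ i, (G.pa i → 𝒳) → PMF 𝒳) (i : V) (x : V → 𝒳) :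
    ∑ v, (θ i (fun j => Function.update x i v j) (Function.update x i v i)).toReal = 1 := by
  have h1 : ∀ v, (fun j : G.pa i => Function.update x i v j) = fun j : G.pa i => x j := by
    intro v
    ext j
    rw [Function.update_of_ne]
    intro h
    have := j.2
    rw [h] at this
    exact G.notMem_pa_self i this
  simp only [h1, Function.update_self]
  exact sum_toReal _

theorem Factorizes.exists_kernels {P : PMF (V → 𝒳)} {G : DAG V} (h : Factorizes P G) :
    ∃ c : V → (V → 𝒳) → ℝ,
      (∀ i x x', (∀ j ∈ insert i (G.pa i), x j = x' j) → c i x = c i x') ∧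
      (∀ i x, ∑ v, c i (Function.update x i v) = 1) ∧
      (fun y => (P y).toReal) = fun y => ∏ i, c i y := by
  obtain ⟨θ, hθ⟩ := h
  refine ⟨fun i x => (θ i (fun j => x j) (x i)).toReal, ?_, ?_, ?_⟩
  · exact kernel_congr θ
  · exact sum_kernel θ
  · ext y
    rw [hθ, ENNReal.toReal_prod]

theorem Factorizes.marg_mul {P : PMF (V → 𝒳)} {G : DAG V} (h : Factorizes P G) {A : Finset V}
    (hA : G.IsAncestral A) {i : V} (hi : i ∉ A) (hpa : G.pa i ⊆ A) (x : V → 𝒳) :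
    marg (fun y => (P y).toReal) (insert i A) x * marg (fun y => (P y).toReal) (G.pa i) x =
      marg (fun y => (P y).toReal) (insert i (G.pa i)) x *
        marg (fun y => (P y).toReal) A x := by
  obtain ⟨c, h1, h2, h3⟩ := h.exists_kernels
  rw [h3]
  exact marg_prod_mul h1 h2 hA hi hpa x

-- The ordered Markov property: a node is independent of earlier nodes given its parents. These are
-- the only constraints needed to recover the factorization.
omit [Fintype 𝒳] in
theorem triple_mem_ciConstraints {G : DAG V} {A : Finset V} (hA : G.IsAncestral A) {i : V}
    (hi : i ∉ A) (hpa : G.pa i ⊆ A) : ({i}, A \ G.pa i, G.pa i) ∈ ciConstraints G := by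
  have d1 : Disjoint {i} (A \ G.pa i) := by simp [hi]
  have d2 : Disjoint {i} (G.pa i) := by simpa using G.notMem_pa_self i
  have d3 : Disjoint (A \ G.pa i) (G.pa i) := Finset.sdiff_disjoint
  refine ⟨d1, d2, d3, fun 𝒳 _ P hP => (condIndep_iff_marg P d1 d2 d3).2 fun x => ?_⟩
  rw [Finset.union_assoc, Finset.sdiff_union_of_subset hpa, ← Finset.insert_eq, ← Finset.insert_eq]
  exact hP.marg_mul hA hi hpa x

/-! ### Projection on the distributions generated by a graph. -/

theorem exists_condLaw {Ω A B : Type*} [Fintype Ω] [Fintype A] (P : PMF Ω) (f : Ω → A)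
    (g : Ω → B) : ∃ κ : B → PMF A, ∀ ω, P ω ≠ 0 → (κ (g ω) (f ω)).toReal =
      law P (fun ω => (f ω, g ω)) (f ω, g ω) / law P g (g ω) := by
  have : ∀ b, ∃ κ : PMF A, law P g b ≠ 0 → ∀ a, (κ a).toReal =
      law P (fun ω => (f ω, g ω)) (a, b) / law P g b := by
    intro b
    by_cases h : law P g b = 0
    -- At null values of `g` any law serves; the kernel only has to be a probability law.
    · exact ⟨P.map f, fun h' => absurd h h'⟩
    · have h0 : ∀ a, 0 ≤ law P (fun ω => (f ω, g ω)) (a, b) / law P g b := fun a =>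
        div_nonneg (law_nonneg _ _ _) (law_nonneg _ _ _)
      refine ⟨PMF.ofFintype (fun a => ENNReal.ofReal
        (law P (fun ω => (f ω, g ω)) (a, b) / law P g b)) ?_, fun _ a => ?_⟩
      · rw [← ENNReal.ofReal_sum_of_nonneg (fun a _ => h0 a), ← Finset.sum_div, sum_law_fst,
          div_self h, ENNReal.ofReal_one]
      · rw [PMF.ofFintype_apply, ENNReal.toReal_ofReal (h0 a)]
  choose κ hκ using this
  refine ⟨κ, fun ω hω => hκ _ ?_ _⟩
  classical
  rw [law_eq_sum]
  refine (lt_of_lt_of_le (toReal_pos_of_ne_zero P hω) ?_).ne'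
  refine le_trans (le_of_eq ?_) (Finset.single_le_sum (f := fun ω' => if g ω' = g ω then
    (P ω').toReal else 0) (fun ω' _ => ?_) (Finset.mem_univ ω))
  · simp
  · split_ifs <;> simp

/-- The projection of `P` on the distributions generated by `G`. -/
theorem exists_projection (P : PMF (V → 𝒳)) (G : DAG V) :
    ∃ Q : PMF (V → 𝒳), Factorizes Q G ∧ ∀ x, P x ≠ 0 → 0 < (Q x).toReal ∧
      Real.log (Q x).toReal = ∑ i, (Real.log (marg (fun y => (P y).toReal) (insert i (G.pa i)) x) -
        Real.log (marg (fun y => (P y).toReal) (G.pa i) x)) := by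
  choose θ hθ using fun i => exists_condLaw P (fun x => x i) (fun x (j : G.pa i) => x j)
  have hsum : ∑ x : V → 𝒳, ∏ i, θ i (fun j => x j) (x i) = 1 := by
    rw [← ENNReal.toReal_eq_one_iff, ENNReal.toReal_sum]
    · simp_rw [ENNReal.toReal_prod]
      obtain ⟨x0, -⟩ := P.support_nonempty
      have := marg_prod (kernel_congr θ) (sum_kernel θ) (A := ∅) (fun i hi => by simp at hi) x0
      rwa [marg_empty, Finset.prod_empty] at this
    · exact fun x _ => ENNReal.prod_ne_top fun i _ => PMF.apply_ne_top _ _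
  refine ⟨PMF.ofFintype _ hsum, ⟨θ, fun x => rfl⟩, fun x hx => ?_⟩
  have hp := fun S => (toReal_pos_of_ne_zero P hx).trans_le
    (le_marg (fun y => ENNReal.toReal_nonneg (a := P y)) S x)
  simp only [PMF.ofFintype_apply, ENNReal.toReal_prod, hθ _ x hx, law_family_eq_marg,
    law_restrict_eq_marg]
  refine ⟨Finset.prod_pos fun i _ => div_pos (hp _) (hp _), ?_⟩
  rw [Real.log_prod (fun i _ => (div_pos (hp _) (hp _)).ne')]
  exact Finset.sum_congr rfl fun i _ => Real.log_div (hp _).ne' (hp _).ne'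

/-- The chain rule along a topological order of `G`: the ordered Markov property replaces the
conditional law given all earlier nodes by the one given the parents. -/
theorem log_eq_sum_of_marg_mul {Q : PMF (V → 𝒳)} {G : DAG V}
    (h : ∀ A i, G.IsAncestral A → i ∉ A → G.pa i ⊆ A → ∀ x,
      marg (fun y => (Q y).toReal) (insert i A) x * marg (fun y => (Q y).toReal) (G.pa i) x =
      marg (fun y => (Q y).toReal) (insert i (G.pa i)) x * marg (fun y => (Q y).toReal) A x)
    {x : V → 𝒳} (hx : 0 < (Q x).toReal) :
    Real.log (Q x).toReal = ∑ i, (Real.log (marg (fun y => (Q y).toReal) (insert i (G.pa i)) x) -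
        Real.log (marg (fun y => (Q y).toReal) (G.pa i) x)) := by
  have hp := fun S => (hx.trans_le (le_marg (fun y => ENNReal.toReal_nonneg (a := Q y)) S x)).ne'
  have key := G.ancestral_induction (C := fun A => Real.log (Q x).toReal =
    Real.log (marg (fun y => (Q y).toReal) A x) +
      ∑ i ∈ Aᶜ, (Real.log (marg (fun y => (Q y).toReal) (insert i (G.pa i)) x) -
        Real.log (marg (fun y => (Q y).toReal) (G.pa i) x))) (by simp [marg_univ]) (by
      intro A i hA hi hpa ih
      have e := congrArg Real.log (h A i hA hi hpa x)
      rw [Real.log_mul (hp _) (hp _), Real.log_mul (hp _) (hp _)] at e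
      rw [ih, Finset.compl_insert, ← Finset.add_sum_erase Aᶜ _ (Finset.mem_compl.2 hi)]
      linarith) ∅ (fun i hi => by simp at hi)
  rw [key, marg_empty, sum_toReal]
  simp

theorem score_eq_expect (P : PMF (V → 𝒳)) (G : DAG V) :
    score P G = ∑ x, (P x).toReal *
      ∑ i, (Real.log (marg (fun y => (P y).toReal) (insert i (G.pa i)) x) -
        Real.log (marg (fun y => (P y).toReal) (G.pa i) x)) := by
  simp_rw [score, familyEntropy_eq_expect, Finset.sum_neg_distrib, neg_neg, Finset.mul_sum]
  exact Finset.sum_comm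

/-- Gibbs' inequality against the conditional law under `Q`. -/
theorem expect_log_le_neg_familyEntropy {P Q : PMF (V → 𝒳)}
    (hPQ : ∀ x, P x ≠ 0 → 0 < (Q x).toReal) (i : V) (S : Finset V) :
    ∑ x, (P x).toReal * (Real.log (marg (fun y => (Q y).toReal) (insert i S) x) -
      Real.log (marg (fun y => (Q y).toReal) S x)) ≤ -familyEntropy P i S := by
  have hp := fun x hx S => (hPQ x hx).trans_le
    (le_marg (fun y => ENNReal.toReal_nonneg (a := Q y)) S x)
  have := (condEntropy_gibbs P (fun x => x i) (fun x (j : S) => x j)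
    (fun u v => law Q (fun x => (x i, fun j : S => x j)) (v, u) /
      law Q (fun x (j : S) => x j) u)
    (fun u v => div_nonneg (law_nonneg _ _ _) (law_nonneg _ _ _))
    (fun u => by
      rw [← Finset.sum_div, sum_law_fst Q (fun x => x i) (fun x (j : S) => x j)]
      exact div_self_le_one _)
    (fun x hx => by
      rw [law_family_eq_marg, law_restrict_eq_marg]
      exact div_pos (hp x hx _) (hp x hx _))).1
  simp only [law_family_eq_marg, law_restrict_eq_marg] at this
  rw [le_neg]
  refine this.trans (le_of_eq (congrArg _ (Finset.sum_congr rfl fun x _ => ?_)))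
  by_cases hx : P x = 0
  · simp [hx]
  · rw [Real.log_div (hp x hx _).ne' (hp x hx _).ne']

end Markov

/-- The score of `G` is the expected log-likelihood under `P` of the projection `Q` of `P` on `G`.
By equivalence `Q` satisfies the constraints of `G'`, so its log-likelihood also splits along `G'`,
and Gibbs' inequality bounds each term by that of `P`. The alphabet is in `Type` because the
constraints quantify over that universe. -/
theorem MarkovEquiv.score_le {V : Type*} {𝒳 : Type} [Fintype V] [DecidableEq V] [Fintype 𝒳]
    {G G' : DAG V} (h : MarkovEquiv G G') (P : PMF (V → 𝒳)) : score P G ≤ score P G' := by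
  obtain ⟨Q, hQ, hPQ⟩ := exists_projection P G
  have hci : ∀ A i, G'.IsAncestral A → i ∉ A → G'.pa i ⊆ A → ∀ x,
      marg (fun y => (Q y).toReal) (insert i A) x * marg (fun y => (Q y).toReal) (G'.pa i) x =
      marg (fun y => (Q y).toReal) (insert i (G'.pa i)) x *
        marg (fun y => (Q y).toReal) A x := by
    intro A i hA hi hpa x
    have hm := triple_mem_ciConstraints hA hi hpa
    rw [← h] at hm
    obtain ⟨d1, d2, d3, hm⟩ := hm
    have := (condIndep_iff_marg Q d1 d2 d3).1 (hm 𝒳 Q hQ) x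
    rwa [Finset.union_assoc, Finset.sdiff_union_of_subset hpa, ← Finset.insert_eq,
      ← Finset.insert_eq] at this
  calc score P G = ∑ x, (P x).toReal *
        ∑ i, (Real.log (marg (fun y => (Q y).toReal) (insert i (G'.pa i)) x) -
          Real.log (marg (fun y => (Q y).toReal) (G'.pa i) x)) := by
        rw [score_eq_expect]
        refine Finset.sum_congr rfl fun x _ => ?_
        by_cases hx : P x = 0
        · simp [hx]
        · rw [← (hPQ x hx).2, ← log_eq_sum_of_marg_mul hci (hPQ x hx).1]
    _ = ∑ i, ∑ x, (P x).toReal *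
          (Real.log (marg (fun y => (Q y).toReal) (insert i (G'.pa i)) x) -
            Real.log (marg (fun y => (Q y).toReal) (G'.pa i) x)) := by
        simp_rw [Finset.mul_sum]
        exact Finset.sum_comm
    _ ≤ ∑ i, -familyEntropy P i (G'.pa i) := Finset.sum_le_sum fun i _ =>
        expect_log_le_neg_familyEntropy (fun x hx => (hPQ x hx).1) i _
    _ = score P G' := by rw [score, Finset.sum_neg_distrib]

/-- Markov equivalent graphs have the same score. -/
theorem MarkovEquiv.score_eq {V : Type*} {𝒳 : Type} [Fintype V] [DecidableEq V] [Fintype 𝒳]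
    {G G' : DAG V} (h : MarkovEquiv G G') (P : PMF (V → 𝒳)) : score P G = score P G' :=
  le_antisymm (h.score_le P) (MarkovEquiv.score_le (Eq.symm h) P)

/-! ### Scores with respect to the noisy copy -/

theorem not_transGen_self_of_rank {V : Type*} {R : V → V → Prop} (r : V → ℕ)
    (hr : ∀ i j, R i j → r i < r j) (v : V) : ¬ Relation.TransGen R v v := by
  suffices ∀ w, Relation.TransGen R v w → r v < r w from fun h => (this v h).false
  intro w h
  induction h with
  | single h => exact hr _ _ h
  | tail _ h ih => exact ih.trans (hr _ _ h)

theorem not_transGen_self_of_add_edge {V : Type*} {R : V → V → Prop}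
    (hR : ∀ v, ¬ Relation.TransGen R v v) {u v : V} (h : ¬ Relation.ReflTransGen R v u) (w : V) :
    ¬ Relation.TransGen (fun x y => R x y ∨ x = u ∧ y = v) w w := by
  -- The second alternative describes a path through the new edge. A second use would require a path
  -- from `v` back to `u`, which `h` excludes.
  have key : ∀ y, Relation.TransGen (fun x y => R x y ∨ x = u ∧ y = v) w y →
      Relation.TransGen R w y ∨ Relation.ReflTransGen R w u ∧ Relation.ReflTransGen R v y := by
    intro y hy
    induction hy with
    | single h1 =>
      rcases h1 with h1 | ⟨rfl, rfl⟩
      · exact Or.inl (.single h1)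
      · exact Or.inr ⟨.refl, .refl⟩
    | tail _ h1 ih =>
      rcases h1 with h1 | ⟨rfl, rfl⟩
      · rcases ih with ih | ih
        · exact Or.inl (ih.tail h1)
        · exact Or.inr ⟨ih.1, ih.2.tail h1⟩
      · rcases ih with ih | ih
        · exact Or.inr ⟨ih.to_reflTransGen, .refl⟩
        · exact absurd ih.2 h
  intro hw
  rcases key w hw with h1 | h1
  · exact hR w h1
  · exact h (h1.2.trans h1.1)

section Score

variable {V 𝒳 : Type*} [Fintype V] [DecidableEq V] [Fintype 𝒳]

theorem familyEntropy_add_comm (P : PMF (V → 𝒳)) (i j : V) (S : Finset V) :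
    familyEntropy P i S + familyEntropy P j (insert i S) =
      familyEntropy P j S + familyEntropy P i (insert j S) := by
  simp only [familyEntropy_eq_ent, Finset.insert_comm i j S]
  ring

theorem score_le_optScore (P : PMF (V → 𝒳)) {k : ℕ} {G : DAG V} (hG : G ∈ structs V k) :
    score P G ≤ optScore P k := by
  refine le_csSup ⟨0, ?_⟩ (Set.mem_image_of_mem _ hG)
  rintro _ ⟨G, -, rfl⟩
  exact neg_nonpos.2 (Finset.sum_nonneg fun i _ => familyEntropy_nonneg _ _ _)

/-! ### Merging the noisy copy into the original. -/

omit [Fintype V] in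
theorem map_some_eraseNone_of_notMem {S : Finset (Option V)} (h : none ∉ S) :
    S.eraseNone.map .some = S := by
  ext o
  cases o <;> simp [h]

omit [Fintype V] in
theorem insert_none_map_some_eraseNone {S : Finset (Option V)} (h : none ∈ S) :
    insert none (S.eraseNone.map .some) = S := by
  ext o
  cases o <;> simp [h]

/-- The parent set on `V` obtained by replacing the noisy copy by the original. -/
def mergeParents (a : V) (S : Finset (Option V)) : Finset V :=
  if none ∈ S then insert a S.eraseNone else S.eraseNone

omit [Fintype V] in
theorem mem_mergeParents {a i : V} {S : Finset (Option V)} :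
    i ∈ mergeParents a S ↔ some i ∈ S ∨ none ∈ S ∧ i = a := by
  unfold mergeParents
  split_ifs with h <;> simp [h, or_comm]

omit [Fintype V] in
theorem card_mergeParents_le (a : V) (S : Finset (Option V)) :
    (mergeParents a S).card ≤ S.card := by
  unfold mergeParents
  split_ifs with h
  · refine (Finset.card_insert_le _ _).trans ?_
    conv_rhs => rw [← insert_none_map_some_eraseNone h]
    rw [Finset.card_insert_of_notMem (by simp), Finset.card_map]
  · exact Finset.card_eraseNone_le S

/-- If the copy is in `S`, adding `X_a` to `S` only lowers the entropy, and next to `X_a` the copy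
carries no further information on `X_i`. -/
theorem familyEntropy_mergeParents_le (P : PMF (V → 𝒳)) (a : V) (ν : PMF 𝒳) (coin : PMF Bool)
    (i : V) (S : Finset (Option V)) : familyEntropy P i (mergeParents a S) ≤
      familyEntropy (noisyCopy P a ν coin) (some i) S := by
  unfold mergeParents
  split_ifs with h
  · rw [← familyEntropy_noisyCopy_insert_none P ν coin i (Finset.mem_insert_self a S.eraseNone)]
    refine familyEntropy_anti _ fun o ho => ?_
    cases o <;> simp [ho]
  · rw [← familyEntropy_noisyCopy_map_some P a ν coin, map_some_eraseNone_of_notMem h]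

theorem familyEntropy_none_ge (P : PMF (V → 𝒳)) (a : V) (ν : PMF 𝒳) (coin : PMF Bool)
    {S : Finset (Option V)} (h : none ∉ S) : familyEntropy (noisyCopy P a ν coin) none {some a} ≤
      familyEntropy (noisyCopy P a ν coin) none S := by
  rw [← familyEntropy_noisyCopy_none P ν coin (Finset.mem_insert_self a S.eraseNone)]
  refine familyEntropy_anti _ fun o ho => ?_
  cases o with
  | none => exact absurd ho h
  | some i => simp [ho]

/-- The chain rule for the pair `X_a`, `X_b` given `X_S` in both orders, with `X_b` screened off by
`X_a`. -/
theorem familyEntropy_none_map_some (P : PMF (V → 𝒳)) (a : V) (ν : PMF 𝒳) (coin : PMF Bool)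
    (S : Finset V) : familyEntropy (noisyCopy P a ν coin) none (S.map .some) +
      familyEntropy (noisyCopy P a ν coin) (some a) (insert none (S.map .some)) =
      familyEntropy P a S + familyEntropy (noisyCopy P a ν coin) none {some a} := by
  have h : insert (some a) (S.map .some) = (insert a S).map .some := by simp
  rw [familyEntropy_add_comm, familyEntropy_noisyCopy_map_some, h,
    familyEntropy_noisyCopy_none P ν coin (Finset.mem_insert_self a S)]

theorem score_option (Q : PMF (Option V → 𝒳)) (G : DAG (Option V)) :
    score Q G = -(familyEntropy Q none (G.pa none) +
      ∑ i : V, familyEntropy Q (some i) (G.pa (some i))) := by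
  rw [score, Fintype.sum_option]

/-- Merging the noisy copy into the original yields an upper bound on the score. -/
theorem exists_score_le_merge (P : PMF (V → 𝒳)) (a : V) (ν : PMF 𝒳) (coin : PMF Bool) {k : ℕ}
    {G : DAG (Option V)} (hG : G ∈ structs (Option V) k) :
    ∃ G₁ ∈ structs V k, score (noisyCopy P a ν coin) G ≤ score P G₁ -
      familyEntropy (noisyCopy P a ν coin) none {some a} +
      familyEntropy (noisyCopy P a ν coin) (some a) {none} := by
  have h0 := familyEntropy_nonneg (noisyCopy P a ν coin) (some a) {none}
  -- If `X_b` is an ancestor of `X_a`, the merged node takes the place of `X_b`; otherwise it takes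
  -- that of `X_a`. Either choice avoids cycles in its case.
  by_cases h : Relation.TransGen (fun i j => i ∈ G.pa j) none (some a)
  · let φ : V → Option V := fun i => if i = a then none else some i
    let pa₁ : V → Finset V := fun i =>
      if i = a then (G.pa none).eraseNone else mergeParents a (G.pa (some i))
    have hφ : ∀ i j, i ∈ pa₁ j → Relation.TransGen (fun i j => i ∈ G.pa j) (φ i) (φ j) := by
      intro i j hij
      by_cases hj : j = a
      · simp only [pa₁, hj, if_true, Finset.mem_eraseNone] at hij
        have hi : i ≠ a := by
          rintro rfl
          exact G.acyclic _ (h.tail hij)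
        simp only [φ, hj, hi, if_true, if_false]
        exact .single hij
      · simp only [pa₁, hj, if_false, mem_mergeParents] at hij
        simp only [φ, hj, if_false]
        by_cases hi : i = a
        · simp only [hi, if_true]
          rcases hij with hij | hij
          · exact h.tail (hi ▸ hij)
          · exact .single hij.1
        · simp only [hi, if_false]
          rcases hij with hij | hij
          · exact .single hij
          · exact absurd hij.2 hi
    refine ⟨⟨pa₁, fun v hv => G.acyclic _ (Relation.TransGen.lift' φ hφ _ _ hv)⟩, fun i => ?_, ?_⟩
    · change (pa₁ i).card ≤ k
      simp only [pa₁]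
      split_ifs
      · exact (Finset.card_eraseNone_le _).trans (hG _)
      · exact (card_mergeParents_le _ _).trans (hG _)
    -- The family of `X_a` in `G` is bounded below by zero, and `e` trades `H(b ∣ Π_b)` for `H(a ∣
    -- Π_b) + H(b ∣ a)` at a cost of at most `H(a ∣ b)`.
    · have e := familyEntropy_none_map_some P a ν coin (G.pa none).eraseNone
      rw [map_some_eraseNone_of_notMem (G.notMem_pa_self none)] at e
      have h1 : familyEntropy (noisyCopy P a ν coin) (some a) (insert none (G.pa none)) ≤
          familyEntropy (noisyCopy P a ν coin) (some a) {none} :=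
        familyEntropy_anti _ (by simp)
      have h2 := familyEntropy_nonneg (noisyCopy P a ν coin) (some a) (G.pa (some a))
      rw [score_option, score, ← Finset.add_sum_erase _ _ (Finset.mem_univ a),
        ← Finset.add_sum_erase _ (fun i => familyEntropy P i (pa₁ i)) (Finset.mem_univ a)]
      have h3 : ∑ i ∈ Finset.univ.erase a, familyEntropy P i (pa₁ i) ≤
          ∑ i ∈ Finset.univ.erase a, familyEntropy (noisyCopy P a ν coin) (some i)
            (G.pa (some i)) := by
        refine Finset.sum_le_sum fun i hi => ?_
        simp only [pa₁, if_neg (Finset.ne_of_mem_erase hi)]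
        exact familyEntropy_mergeParents_le P a ν coin i _
      have h4 : pa₁ a = (G.pa none).eraseNone := if_pos rfl
      rw [h4]
      linarith
  -- The edge `a → b` can be added without a cycle, and every edge `a → j` created by the merge
  -- lifts to the path `a → b → j`.
  · let R : Option V → Option V → Prop := fun i j => i ∈ G.pa j ∨ i = some a ∧ j = none
    have hR : ∀ v, ¬ Relation.TransGen R v v := by
      refine not_transGen_self_of_add_edge G.acyclic fun h1 => ?_
      rcases Relation.reflTransGen_iff_eq_or_transGen.1 h1 with h2 | h2
      · simp at h2
      · exact h h2
    refine ⟨⟨fun i => mergeParents a (G.pa (some i)), fun v hv => hR (some v)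
      (Relation.TransGen.lift' some (fun i j hij => ?_) _ _ hv)⟩, fun i => ?_, ?_⟩
    · rcases mem_mergeParents.1 hij with h1 | ⟨h1, rfl⟩
      · exact .single (Or.inl h1)
      · exact .tail (.single (Or.inr ⟨rfl, rfl⟩)) (Or.inl h1)
    · exact (card_mergeParents_le _ _).trans (hG _)
    · rw [score_option, score]
      have h1 := Finset.sum_le_sum fun i (_ : i ∈ Finset.univ) =>
        familyEntropy_mergeParents_le P a ν coin i (G.pa (some i))
      have h2 := familyEntropy_none_ge P a ν coin (G.notMem_pa_self none)
      linarith

theorem optScore_noisyCopy_le (P : PMF (V → 𝒳)) (a : V) (ν : PMF 𝒳) (coin : PMF Bool) (k : ℕ)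
    (hne : (structs (Option V) k).Nonempty) :
    optScore (noisyCopy P a ν coin) k ≤ optScore P k -
      familyEntropy (noisyCopy P a ν coin) none {some a} +
      familyEntropy (noisyCopy P a ν coin) (some a) {none} := by
  refine csSup_le (hne.image _) ?_
  rintro _ ⟨G, hG, rfl⟩
  obtain ⟨G₁, hG₁, hle⟩ := exists_score_le_merge P a ν coin hG
  linarith [score_le_optScore P hG₁]

/-! ### The two competing graphs. -/

/-- The graph in which the noisy copy is a child of the original. -/
theorem exists_copy_as_child (P : PMF (V → 𝒳)) (a : V) (ν : PMF 𝒳) (coin : PMF Bool) {k : ℕ}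
    (hk : 1 ≤ k) {G : DAG V} (hG : G ∈ structs V k) : ∃ G' ∈ structs (Option V) k,
      score (noisyCopy P a ν coin) G' =
        score P G - familyEntropy (noisyCopy P a ν coin) none {some a} := by
  obtain ⟨r, hr⟩ := G.exists_rank
  refine ⟨⟨fun o => o.elim {some a} fun i => (G.pa i).map .some,
    not_transGen_self_of_rank (fun o => o.elim (r a + 1) r) fun i j hij => ?_⟩, fun o => ?_, ?_⟩
  · cases j with
    | none =>
      obtain rfl : i = some a := by simpa using hij
      exact Nat.lt_succ_self _
    | some j =>
      cases i with
      | none => simp at hij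
      | some i => exact hr i j (by simpa using hij)
  · cases o with
    | none => simpa using hk
    | some i => simpa using hG i
  · rw [score_option, score]
    simp only [Option.elim, familyEntropy_noisyCopy_map_some]
    ring

/-- The graph in which the noisy copy takes the place of a childless original, whose only parent
it becomes. -/
theorem exists_copy_as_parent (P : PMF (V → 𝒳)) (a : V) (ν : PMF 𝒳) (coin : PMF Bool) {k : ℕ}
    (hk : 1 ≤ k) {G : DAG V} (hG : G ∈ structs V k) (ha : ∀ j, a ∉ G.pa j) :
    ∃ G' ∈ structs (Option V) k, score (noisyCopy P a ν coin) G' =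
        score P G - familyEntropy (noisyCopy P a ν coin) none {some a} -
          familyEntropy (noisyCopy P a ν coin) (some a) {none} +
          familyEntropy (noisyCopy P a ν coin) (some a) (insert none ((G.pa a).map .some)) := by
  obtain ⟨r, hr⟩ := G.exists_rank
  refine ⟨⟨fun o => o.elim ((G.pa a).map .some) fun i => if i = a then {none} else
    -- Doubling the ranks leaves room to place `X_a` directly above the copy, which inherits its old
    -- position. The raised rank is harmless because `X_a` has no children.
    (G.pa i).map .some, not_transGen_self_of_rank (fun o => o.elim (2 * r a) fun i =>
      2 * r i + if i = a then 1 else 0) fun i j hij => ?_⟩, fun o => ?_, ?_⟩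
  · have hlt : ∀ i j, i ∈ G.pa j → (2 * r i + if i = a then 1 else 0) < 2 * r j := by
      intro i j h
      rw [if_neg (by rintro rfl; exact ha j h)]
      have := hr i j h
      omega
    cases j with
    | none =>
      cases i with
      | none => simp at hij
      | some i => exact hlt i a (by simpa using hij)
    | some j =>
      by_cases hj : j = a
      · subst hj
        obtain rfl : i = none := by simpa using hij
        simp
      · cases i with
        | none => simp [hj] at hij
        | some i =>
          have := hlt i j (by simpa [hj] using hij)
          simpa [hj] using this
  · cases o with
    | none => simpa using hG a
    | some i =>
      by_cases hi : i = a
      · simpa [hi] using hk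
      · simpa [hi] using hG i
  · have e := familyEntropy_none_map_some P a ν coin (G.pa a)
    rw [score_option, score, ← Finset.add_sum_erase _ _ (Finset.mem_univ a),
      ← Finset.add_sum_erase _ (fun i => familyEntropy P i (G.pa i)) (Finset.mem_univ a)]
    simp only [Option.elim, if_true]
    have h3 : ∑ i ∈ Finset.univ.erase a, familyEntropy (noisyCopy P a ν coin) (some i)
        (if i = a then {none} else (G.pa i).map .some) =
        ∑ i ∈ Finset.univ.erase a, familyEntropy P i (G.pa i) := by
      refine Finset.sum_congr rfl fun i hi => ?_
      rw [if_neg (Finset.ne_of_mem_erase hi), familyEntropy_noisyCopy_map_some]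
    rw [h3]
    linarith

/-! ### Strictness: dependence of the original on its parents. -/

/-- If `X_a` and `X_S` are independent given a properly noisy copy of `X_a`, then they are
independent. -/
theorem familyEntropy_eq_of_noisyCopy_eq (P : PMF (V → 𝒳)) {a : V} (ν : PMF 𝒳) {coin : PMF Bool}
    (h0 : 0 < (coin true).toReal) (h1 : (coin true).toReal < 1) {S : Finset V} (ha : a ∉ S)
    (h : familyEntropy (noisyCopy P a ν coin) (some a) (insert none (S.map .some)) =
      familyEntropy (noisyCopy P a ν coin) (some a) {none}) :
    familyEntropy P a S = familyEntropy P a ∅ := by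
  classical
  have hm := (familyEntropy_anti_and_eq (noisyCopy P a ν coin) (i := some a) (S := {none})
    (T := insert none (S.map .some)) (by simp)).2 h
  -- Conditioning on a value `b` that the noise can produce makes the kernel positive at `b`
  -- whatever the value of `X_a`, so it can be cancelled.
  obtain ⟨b, hb⟩ := ν.support_nonempty
  have hν := toReal_pos_of_ne_zero ν hb
  set p := (coin true).toReal
  have hq : 0 < (1 - p) * (ν b).toReal := mul_pos (by linarith) hν
  set q := (1 - p) * (ν b).toReal with hq_def
  have hp : ∀ x, 0 ≤ (P x).toReal := fun _ => ENNReal.toReal_nonneg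
  have key : ∀ x : V → 𝒳, marg (fun y => (P y).toReal) (insert a S) x *
      (p * marg (fun y => (P y).toReal) {a} (Function.update x a b) + q) =
      marg (fun y => (P y).toReal) {a} x *
      (p * marg (fun y => (P y).toReal) (insert a S) (Function.update x a b) +
        q * marg (fun y => (P y).toReal) S x) := by
    intro x
    have := hm (fun o => o.elim b x)
    have e1 : insert (some a) (insert none (S.map .some)) =
        insert none ((insert a S).map .some) := by
      ext o; cases o <;> simp
    have e2 : insert (some a) ({none} : Finset (Option V)) =
        insert none (({a} : Finset V).map .some) := by
      ext o; cases o <;> simp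
    have e3 : ({none} : Finset (Option V)) = insert none ((∅ : Finset V).map .some) := by simp
    have e4 : (fun o : Option V => o.elim b x) ∘ some = x := rfl
    rw [e1, e2, e3, marg_noisyCopy_insert_none P ν coin (Finset.mem_insert_self a S),
      marg_noisyCopy_insert_none P ν coin (Finset.mem_singleton_self a),
      marg_noisyCopy_none P ν coin ha, marg_noisyCopy_none P ν coin (Finset.notMem_empty a), e4,
      marg_empty, sum_toReal, mul_one, insert_empty_eq] at this
    simp only [Option.elim] at this
    have hκ : 0 < copyKernel p ν (x a) b := by
      rw [copyKernel]
      have : 0 ≤ p * (if x a = b then 1 else 0) := by split_ifs <;> simp [h0.le]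
      linarith
    refine mul_right_cancel₀ hκ.ne' ?_
    linear_combination this
  refine familyEntropy_of_indep P fun x => ?_
  set x' := Function.update x a b with hx'
  have hS : marg (fun y => (P y).toReal) S x' = marg (fun y => (P y).toReal) S x :=
    marg_congr _ fun j hj => Function.update_of_ne (by rintro rfl; exact ha hj) _ _
  -- At `X_a = b` the terms with factor `p` cancel, which gives independence at that value.
  -- Inserting this in the identity at `x` gives it at every value.
  have k1 := key x'
  have k2 := key x
  rw [hS, hx', Function.update_idem, ← hx'] at k1
  have k3 : marg (fun y => (P y).toReal) (insert a S) x' =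
      marg (fun y => (P y).toReal) {a} x' * marg (fun y => (P y).toReal) S x := by
    refine mul_right_cancel₀ hq.ne' ?_
    linear_combination k1
  rw [← hx', k3] at k2
  have hN : 0 < p * marg (fun y => (P y).toReal) {a} x' + q :=
    add_pos_of_nonneg_of_pos (mul_nonneg h0.le (marg_nonneg hp _ _)) hq
  refine mul_right_cancel₀ hN.ne' ?_
  linear_combination k2

/-- Take a node of least rank among those other than `a`; a parent of it would have smaller rank and
so be `a`, which has no children. -/
theorem exists_root_ne (hV : 2 ≤ Fintype.card V) {G : DAG V} {a : V} (ha : ∀ j, a ∉ G.pa j) :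
    ∃ v, v ≠ a ∧ G.pa v = ∅ := by
  obtain ⟨r, hr⟩ := G.exists_rank
  have hne : (Finset.univ.erase a).Nonempty := by
    rw [← Finset.card_pos, Finset.card_erase_of_mem (Finset.mem_univ a), Finset.card_univ]
    omega
  obtain ⟨v, hv, hmin⟩ := Finset.exists_min_image _ r hne
  refine ⟨v, Finset.ne_of_mem_erase hv, Finset.eq_empty_of_forall_notMem fun j hj => ?_⟩
  refine (hr j v hj).not_ge (hmin j (Finset.mem_erase.2 ⟨?_, Finset.mem_univ _⟩))
  rintro rfl
  exact ha v hj

/-- In the graphs of the optimal class, `X_a` depends on its parents. -/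
theorem IsBase.familyEntropy_ne {P : PMF (V → 𝒳)} {a : V} {k : ℕ} {α β : ℝ}
    (hP : IsBase P a k α β) (hβ : 0 < β) (hk : 1 ≤ k) (hV : 2 ≤ Fintype.card V)
    {E : Set (DAG V)} (hE : IsOptimalEC P k E) {G : DAG V} (hG : G ∈ E) (hGk : G ∈ structs V k) :
    familyEntropy P a (G.pa a) ≠ familyEntropy P a ∅ := by
  intro heq
  have ha := hP.childless E hE G hG
  obtain ⟨v, hva, hv⟩ := exists_root_ne hV ha
  obtain ⟨r, hr⟩ := G.exists_rank
  -- If `X_a` is independent of its parents, cutting them off costs nothing, and giving the root `v`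
  -- the parent `a` costs nothing either. In the result `a` has a child, so it lies outside the
  -- optimal class although its score is optimal.
  let pa' : V → Finset V := fun i => if i = a then ∅ else if i = v then {a} else G.pa i
  have hacyc : ∀ w, ¬ Relation.TransGen (fun i j => i ∈ pa' j) w w := by
    refine not_transGen_self_of_rank (fun i => if i = a then 0 else r i + 1) fun i j hij => ?_
    by_cases hj : j = a
    · simp [pa', hj] at hij
    · by_cases hjv : j = v
      · have : i = a := by simpa [pa', hjv, hva] using hij
        simp [this, hj]
      · have hij' : i ∈ G.pa j := by simpa [pa', hj, hjv] using hij
        have hi : i ≠ a := by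
          rintro rfl
          exact ha j hij'
        simpa [hi, hj] using hr i j hij'
  let R : DAG V := ⟨pa', hacyc⟩
  have hR : R ∈ structs V k := by
    intro i
    change (pa' i).card ≤ k
    simp only [pa']
    split_ifs
    · simp
    · simpa using hk
    · exact hGk i
  have hscore : score P G ≤ score P R := by
    refine neg_le_neg (Finset.sum_le_sum fun i _ => ?_)
    change familyEntropy P i (pa' i) ≤ _
    by_cases hi : i = a
    · simp [pa', hi, heq]
    · by_cases hiv : i = v
      · simp only [pa', hiv, hva, if_true, if_false, hv]
        exact familyEntropy_anti P (Finset.empty_subset _)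
      · simp [pa', hi, hiv]
  obtain ⟨E₀, hE₀, huniq, hgap⟩ := hP.gap
  have hRE : R ∈ {G' ∈ structs V k | MarkovEquiv R G'} := ⟨hR, rfl⟩
  have hne : {G' ∈ structs V k | MarkovEquiv R G'} ≠ E₀ := by
    intro h
    refine hP.childless E₀ hE₀ R (h ▸ hRE) v ?_
    change a ∈ pa' v
    simp [pa', hva]
  have := hgap _ ⟨R, hR, rfl⟩ hne R hRE
  linarith [hE.2 G hG]

end Score

end BayesNet

theorem theorem4 {V : Type*} {𝒳 : Type} [Fintype V] [DecidableEq V] [Fintype 𝒳]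
    (k : ℕ) (hk : 1 ≤ k) (hV : 2 ≤ Fintype.card V)
    (a : V) (P : PMF (V → 𝒳)) (α β : ℝ) (hα : 0 < α) (hβ : 0 < β)
    (hP : BayesNet.IsBase P a k α β)
    (d : ℕ) (hd : d = Fintype.card (Option V))
    (ε : ℝ) (hε : ε ∈ Set.Ioo 0 (2 * min α (β / (3 * d)))) :
    ∃ l ∈ Set.Ioo 0 (min α (β / (3 * d))), ∀ ν : PMF 𝒳,
      (∃ coin : PMF Bool, BayesNet.noiseLevel (BayesNet.noisyCopy P a ν coin) a = l) ∧
      ∀ coin : PMF Bool, BayesNet.noiseLevel (BayesNet.noisyCopy P a ν coin) a = l →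
        ∃ E ∈ BayesNet.ecs (Option V) k, ¬ BayesNet.IsOptimalEC (BayesNet.noisyCopy P a ν coin) k E ∧
          ∀ G ∈ E, BayesNet.score (BayesNet.noisyCopy P a ν coin) G <
              BayesNet.optScore (BayesNet.noisyCopy P a ν coin) k ∧
            BayesNet.optScore (BayesNet.noisyCopy P a ν coin) k - ε ≤
              BayesNet.score (BayesNet.noisyCopy P a ν coin) G := by
  open BayesNet in
  have hl : ε / 2 < min α (β / (3 * d)) := by linarith [hε.2]
  have hl0 : 0 < ε / 2 := half_pos hε.1
  have hlα : ε / 2 < familyEntropy P a (Finset.univ.erase a) := by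
    rw [hP.entropy]
    exact hl.trans_le (min_le_left _ _)
  -- The score of `G₂` falls short of the optimum by at most twice the noise level, hence the level
  -- `ε / 2`.
  refine ⟨ε / 2, ⟨hl0, hl⟩, fun ν => ⟨exists_coin_noiseLevel_eq P a ν hl0.le hlα.le,
    fun coin hcoin => ?_⟩⟩
  have h0 : 0 < (coin true).toReal := by
    refine toReal_pos_of_ne_zero coin fun h => ?_
    linarith [le_noiseLevel_of_coin_eq_zero P a ν h]
  have h1 : (coin true).toReal < 1 := by
    refine lt_of_le_of_ne ?_ fun h => ?_
    · linarith [coin_false_toReal coin, ENNReal.toReal_nonneg (a := coin false)]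
    · linarith [noiseLevel_of_coin_eq_one P a ν h]
  obtain ⟨E, hE, -⟩ := hP.gap
  obtain ⟨G, hG, hEG⟩ := hE.1
  have hGE : G ∈ E := by
    rw [hEG]
    exact ⟨hG, rfl⟩
  have hchild := hP.childless E hE G hGE
  obtain ⟨G₁, hG₁, hs₁⟩ := exists_copy_as_child P a ν coin hk hG
  obtain ⟨G₂, hG₂, hs₂⟩ := exists_copy_as_parent P a ν coin hk hG hchild
  have hab : familyEntropy (noisyCopy P a ν coin) (some a) {none} ≤ ε / 2 := by
    rw [← hcoin, noiseLevel_eq]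
    exact le_max_right _ _
  have hopt := optScore_noisyCopy_le P a ν coin k ⟨G₁, hG₁⟩
  have hle := score_le_optScore (noisyCopy P a ν coin) hG₁
  have hGopt := hE.2 G hGE
  have hnn := familyEntropy_nonneg (noisyCopy P a ν coin) (some a)
    (insert none ((G.pa a).map .some))
  -- This strict inequality puts `G₂` strictly below `G₁`, and hence below the optimum.
  have hlt : familyEntropy (noisyCopy P a ν coin) (some a) (insert none ((G.pa a).map .some)) <
      familyEntropy (noisyCopy P a ν coin) (some a) {none} :=
    lt_of_le_of_ne (familyEntropy_anti _ (by simp)) fun h =>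
      hP.familyEntropy_ne hβ hk hV hE hGE hG
        (familyEntropy_eq_of_noisyCopy_eq P ν h0 h1 (G.notMem_pa_self a) h)
  refine ⟨{G' ∈ structs (Option V) k | MarkovEquiv G₂ G'}, ⟨G₂, hG₂, rfl⟩, fun h => ?_,
    fun G' hG' => ?_⟩
  · linarith [h.2 G₂ ⟨hG₂, rfl⟩]
  · rw [← hG'.2.score_eq]
    constructor <;> linarith
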